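/- Let $N$ players have action sets $A_i\subseteq\mathbb R^d$ and cost functions $J_i:\mathbb R^{Nd}\to\mathbb R$, $i=1,\dots,N$; put $A=A_1\times\dots\times A_N$. Write $a=(a^1,\dots,a^N)\in\mathbb R^{Nd}$ with $a^i\in\mathbb R^d$, and $(z,a^{-i})$ for $a$ with $a^i$ replaced by $z$; norms and inner products are Euclidean. A Nash equilibrium is a point $a^*\in A$ with $J_i(a^*)\le J_i(z,a^{*,-i})$ for all $i$ and all $z\in A_i$. Assume: 1. every $A_i$ is closed and convex, every $J_i$ is continuously differentiable on $\mathbb R^{Nd}$, and $z\mapsto J_i(z,a^{-i})$ is convex on $\mathbb R^d$ for each fixed $a^{-i}$; 2. the game mapping $M=(M_1,\dots,M_N)$, $M_i(a)=\nabla_{a^i}J_i(a)$, is monotone on $A$: $(M(a)-M(a'),a-a')\ge 0$ for all $a,a'\in A$; 3. the variational inequality has a solution: there is $y\in A$ with $(M(y),z-y)\ge0$ for all $z\in A$; 4. each $M_i:\mathbb R^{Nd}\to\mathbb R^d$ is Lipschitz continuous; 5. the costs grow at most linearly: $|J_i(a)|=O(\|a\|)$ as $\|a\|\to\infty$, for every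 $i$; 6. for some $\alpha,b,c>0$ one has $\gamma(t)=t^{-\alpha}$, $\sigma(t)=t^{-b}$, $\varepsilon(t)=t^{-c}$ for all integers $t\ge1$, while $\gamma(0),\sigma(0),\varepsilon(0)>0$ are arbitrary, and with $\beta(t)=\gamma(t)\sigma^2(t)$: (a) $\sum_{t\ge 0}\beta(t)=\infty$ and $\varepsilon(t)\to0$; (b) $\sum_{t\ge1}\bigl(1+\tfrac1{\beta(t)\varepsilon(t)}\bigr)\tfrac{|\varepsilon(t-1)-\varepsilon(t)|^2}{\varepsilon(t)^2}<\infty$; (c) $\sum_{t\ge 0}\gamma(t)^2<\infty$ and $\sum_{t\ge 0}\beta(t)\sigma(t)<\infty$; (d) $\sigma(t)\to0$ and $\sum_{t\ge 0}\beta(t)\varepsilon(t)=\infty$. Let $\mu(0)\in\mathbb R^{Nd}$ be an arbitrary deterministic point. For $t=0,1,2,\dots$, conditionally on the past (the states $x(s)$, $s<t$, and the means $\mu(s)$, $s\le t$), let the coordinates $x^i_k(t)$ of the joint state $x(t)=(x^1(t),\dots,x^N(t))$ be independent normal random variables with means $\mu^i_k(t)$ and standard deviation $\sigma(t)$, and let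 $$\mu^i(t+1)=\mathrm{Proj}_{A_i}\Bigl[\mu^i(t)-\gamma(t)\sigma^2(t)\Bigl(J_i(x(t))\,\frac{x^i(t)-\mu^i(t)}{\sigma^2(t)}+\varepsilon(t)\mu^i(t)\Bigr)\Bigr],\qquad i=1,\dots,N,$$ where $\mathrm{Proj}_{A_i}$ is the Euclidean projection on $A_i$. Then there is a Nash equilibrium $a^*$ of the game, of least norm among all its Nash equilibria, such that $\mu(t)\to a^*$ almost surely and $x(t)\to a^*$ in probability as $t\to\infty$. -/

import Mathlib

open MeasureTheory ProbabilityTheory Filter Topology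

noncomputable section

namespace PayoffLearning

/-- The action space `ℝ^d` of one player, with the Euclidean norm. -/
abbrev Action (d : ℕ) : Type := EuclideanSpace ℝ (Fin d)

/-- Joint actions `(a^1, …, a^N)`, that is `ℝ^{Nd}` with the Euclidean norm. -/
abbrev Joint (N d : ℕ) : Type := PiLp 2 (fun _ : Fin N => Action d)

/-- The joint action `(z, a^{-i})`: the action of player `i` is replaced by `z`. -/
def Joint.replace {N d : ℕ} (a : Joint N d) (i : Fin N) (z : Action d) : Joint N d :=
  WithLp.toLp 2 (Function.update a.ofLp i z)

/-- A game with `N` players, action sets `A i ⊆ ℝ^d` and cost functions `J i` on `ℝ^{Nd}`. -/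
structure Game (N d : ℕ) where
  A : Fin N → Set (Action d)
  J : Fin N → Joint N d → ℝ

variable {N d : ℕ}

/-- The set `A_1 × … × A_N` of joint actions of the game. -/
def Game.jointSet (G : Game N d) : Set (Joint N d) :=
  {a | ∀ i, a i ∈ G.A i}

/-- The game is convex: closed convex action sets, and continuously differentiable costs that are
convex in the player's own action. -/
structure Game.IsConvex (G : Game N d) : Prop where
  convex_set : ∀ i, Convex ℝ (G.A i)
  closed_set : ∀ i, IsClosed (G.A i)
  contDiff_cost : ∀ i, ContDiff ℝ 1 (G.J i)
  convex_cost : ∀ i (a : Joint N d), ConvexOn ℝ Set.univ (fun z => G.J i (a.replace i z))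

/-- The game mapping `M(a) = (∇_{a^i} J_i(a^i, a^{-i}))_i`. -/
def Game.mapping (G : Game N d) (a : Joint N d) : Joint N d :=
  WithLp.toLp 2 (fun i => gradient (fun z => G.J i (a.replace i z)) (a i))

/-- Monotonicity of a mapping over a set. -/
def IsMonotoneOver (T : Joint N d → Joint N d) (Y : Set (Joint N d)) : Prop :=
  ∀ x ∈ Y, ∀ y ∈ Y, 0 ≤ inner ℝ (T x - T y) (x - y)

/-- The solution set `SOL(Y, T)` of the variational inequality `VI(Y, T)`. -/
def viSol (Y : Set (Joint N d)) (T : Joint N d → Joint N d) : Set (Joint N d) :=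
  {y | y ∈ Y ∧ ∀ z ∈ Y, 0 ≤ inner ℝ (T y) (z - y)}

/-- Nash equilibria of the game. -/
def Game.IsNash (G : Game N d) (a : Joint N d) : Prop :=
  a ∈ G.jointSet ∧ ∀ i, ∀ z ∈ G.A i, G.J i a ≤ G.J i (a.replace i z)

/-- Every component `M_i : ℝ^{Nd} → ℝ^d` of the game mapping is Lipschitz. -/
def Game.LipschitzMapping (G : Game N d) : Prop :=
  ∀ i, ∃ L : NNReal, LipschitzWith L (fun a => G.mapping a i)

/-- Every cost grows at most linearly: `J_i(a) = O(‖a‖)` as `‖a‖ → ∞`. -/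
def Game.LinearGrowth (G : Game N d) : Prop :=
  ∀ i, (G.J i) =O[Bornology.cobounded (Joint N d)] (fun a => ‖a‖)

/-- The parameters `γ(t) = t^{-a}`, `σ(t) = t^{-b}`, `ε(t) = t^{-c}` (for `t ≥ 1`, with arbitrary
positive values at `t = 0`), with the summability conditions in which `β(t) = γ(t) σ(t)²`.
The series over `ε(t-1) - ε(t)` starts at `t = 1`. -/
structure StepSizes (a b c : ℝ) (γ σ ε : ℕ → ℝ) : Prop where
  a_pos : 0 < a
  b_pos : 0 < b
  c_pos : 0 < c
  gamma_eq : ∀ t : ℕ, 1 ≤ t → γ t = 1 / (t : ℝ) ^ a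
  sigma_eq : ∀ t : ℕ, 1 ≤ t → σ t = 1 / (t : ℝ) ^ b
  eps_eq : ∀ t : ℕ, 1 ≤ t → ε t = 1 / (t : ℝ) ^ c
  gamma_zero : 0 < γ 0
  sigma_zero : 0 < σ 0
  eps_zero : 0 < ε 0
  beta_sum : ¬ Summable (fun t => γ t * σ t ^ 2)
  eps_lim : Tendsto ε atTop (𝓝 0)
  drift_sum : Summable (fun t =>
    (1 + 1 / (γ (t + 1) * σ (t + 1) ^ 2 * ε (t + 1))) * (|ε t - ε (t + 1)| ^ 2 / ε (t + 1) ^ 2))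
  gamma_sq_sum : Summable (fun t => γ t ^ 2)
  beta_sigma_sum : Summable (fun t => γ t * σ t ^ 2 * σ t)
  sigma_lim : Tendsto σ atTop (𝓝 0)
  beta_eps_sum : ¬ Summable (fun t => γ t * σ t ^ 2 * ε t)

/-- The law of a joint action whose coordinates `x^i_k` are independent normal variables with
means `m^i_k` and common standard deviation `s`. -/
def playLaw (m : Joint N d) (s : ℝ) : Measure (Joint N d) :=
  (Measure.pi fun i : Fin N =>
    (Measure.pi fun k : Fin d => gaussianReal (m i k) (Real.toNNReal (s ^ 2))).map
      (WithLp.toLp 2)).map (WithLp.toLp 2)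

/-- `p` is the Euclidean projection of `z` on `C`. -/
def IsProj (C : Set (Action d)) (z p : Action d) : Prop :=
  p ∈ C ∧ ∀ q ∈ C, ‖z - p‖ ≤ ‖z - q‖

/-- `(μ, x)` is a run of the regularized payoff-based algorithm with initial mean `m₀`.
The σ-algebra `ℱ t` contains the history before the actions `x t` are drawn; given `ℱ t`, the
joint action `x t` has the normal law with mean `μ t` and standard deviation `σ t`. -/
structure IsRun {Ω : Type*} [mΩ : MeasurableSpace Ω] (P : Measure Ω) (ℱ : Filtration ℕ mΩ)
    (G : Game N d) (γ σ ε : ℕ → ℝ) (m₀ : Joint N d) (μ x : ℕ → Ω → Joint N d) : Prop where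
  init : ∀ ω, μ 0 ω = m₀
  mean_meas : ∀ t, Measurable[ℱ t] (μ t)
  play_meas : ∀ t, Measurable[ℱ (t + 1)] (x t)
  play_law : ∀ t, ∀ B : Set (Joint N d), MeasurableSet B →
    P⟦x t ⁻¹' B | ℱ t⟧ =ᵐ[P] fun ω => (playLaw (μ t ω) (σ t)).real B
  update : ∀ t ω i, IsProj (G.A i)
    (μ t ω i - (γ t * σ t ^ 2) •
      ((G.J i (x t ω) / σ t ^ 2) • (x t ω i - μ t ω i) + ε t • μ t ω i))
    (μ (t + 1) ω i)

end PayoffLearning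

end

/-
For `ε > 0` let `y_ε` be the solution of the variational inequality for the strongly monotone
mapping `M + ε`. As `ε → 0`, the points `y_ε` converge to the solution of least norm of the
variational inequality for `M`, and the solutions of the latter are the Nash equilibria. It remains
to see that the means `μ (t + 1)` follow `y_{ε t}`.

Given the past, the estimate `J_i(x) (x^i - μ^i) / σ²` has the same mean as the one in which the
baseline `J_i(μ^i, x^{-i})` is subtracted from `J_i(x)`, because the Gaussian noise of player `i` is
symmetric. Taylor's formula then shows that the bias with respect to `M` is `O(σ)`, while linear
growth of the costs makes the second moment `O(σ⁻²)`. Writing `β = γ σ²`, one obtains that the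
conditional expectation of `‖μ (t + 1) - y_{ε t}‖²` is at most
`(1 - 2 β ε) ‖μ t - y_{ε t}‖² + O(β σ + γ²) (1 + ‖μ t - y_{ε t}‖²)`.
Young's inequality, with weight `β ε`, replaces `y_{ε t}` by `y_{ε (t - 1)}` on the right, where
`‖y_{ε t} - y_{ε (t - 1)}‖ = O(|ε t - ε (t - 1)| / ε t)`, and the Robbins–Siegmund theorem applies.
-/

namespace PayoffLearning

section VariationalInequality

variable {E : Type*} [NormedAddCommGroup E] [InnerProductSpace ℝ E] {K : Set E} {T : E → E}

/-- `y` solves the variational inequality `VI(K, T)`; this is membership in `viSol` for an arbitrary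
inner product space. The metric projection of `z` on a convex set is encoded as a solution of
`VI(K, · - z)`. -/
def IsVISol (K : Set E) (T : E → E) (y : E) : Prop :=
  y ∈ K ∧ ∀ z ∈ K, 0 ≤ inner ℝ (T y) (z - y)

/-- Monotonicity of an operator on a set; this is `IsMonotoneOver` for an arbitrary inner product
space. -/
def IsMonotoneMapOn (T : E → E) (K : Set E) : Prop :=
  ∀ u ∈ K, ∀ v ∈ K, 0 ≤ inner ℝ (T u - T v) (u - v)

/-- The Tikhonov regularization `T + ε • id` of an operator. -/
def regularize (T : E → E) (ε : ℝ) (u : E) : E :=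
  T u + ε • u

theorem isVISol_sub_of_forall_norm_sub_le (hK : Convex ℝ K) {z p : E} (hp : p ∈ K)
    (h : ∀ q ∈ K, ‖z - p‖ ≤ ‖z - q‖) : IsVISol K (· - z) p := by
  refine ⟨hp, fun w hw => ?_⟩
  have : Nonempty K := ⟨⟨p, hp⟩⟩
  have hmin : ‖z - p‖ = ⨅ q : K, ‖z - q‖ := by
    refine le_antisymm (le_ciInf fun q => h q q.2) (ciInf_le ⟨0, ?_⟩ (⟨p, hp⟩ : K))
    rintro _ ⟨q, rfl⟩
    exact norm_nonneg _
  have := (norm_eq_iInf_iff_real_inner_le_zero hK hp).1 hmin w hw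
  simpa only [← neg_sub z p, inner_neg_left, neg_nonneg] using this

theorem exists_isVISol_sub [CompleteSpace E] (hK : Convex ℝ K) (hc : IsClosed K)
    (hne : K.Nonempty) (z : E) : ∃ p, IsVISol K (· - z) p := by
  obtain ⟨p, hp, h⟩ := exists_norm_eq_iInf_of_complete_convex hne hc.isComplete hK z
  refine ⟨p, isVISol_sub_of_forall_norm_sub_le hK hp fun q hq => h.trans_le ?_⟩
  exact ciInf_le ⟨0, by rintro _ ⟨q, rfl⟩; exact norm_nonneg _⟩ (⟨q, hq⟩ : K)

theorem IsVISol.norm_sub_le_of_sub {z z' p p' : E} (h : IsVISol K (· - z) p)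
    (h' : IsVISol K (· - z') p') : ‖p - p'‖ ≤ ‖z - z'‖ := by
  have key : ‖p - p'‖ * ‖p - p'‖ ≤ inner ℝ (z - z') (p - p') := by
    have h₁ := h.2 p' h'.1
    have h₂ := h'.2 p h.1
    rw [← neg_sub p p', inner_neg_right] at h₁
    rw [← real_inner_self_eq_norm_mul_norm]
    have : inner ℝ (p' - z') (p - p') - inner ℝ (p - z) (p - p')
        = inner ℝ (z - z') (p - p') - inner ℝ (p - p') (p - p') := by
      rw [← inner_sub_left, ← inner_sub_left]; congr 1; abel
    linarith
  rcases (norm_nonneg (p - p')).eq_or_lt with h0 | h0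
  · exact h0 ▸ norm_nonneg _
  · exact le_of_mul_le_mul_right (key.trans (real_inner_le_norm _ _)) h0

theorem isVISol_sub_sub_smul_iff {τ : ℝ} (hτ : 0 < τ) {y : E} :
    IsVISol K (· - (y - τ • T y)) y ↔ IsVISol K T y := by
  simp only [IsVISol, sub_sub_cancel, real_inner_smul_left, mul_nonneg_iff_of_pos_left hτ]

theorem norm_sub_smul_sq_le {p q : E} {κ L τ : ℝ} (hτ : 0 ≤ τ) (hκ : κ * ‖p‖ ^ 2 ≤ inner ℝ q p)
    (hL : ‖q‖ ≤ L * ‖p‖) : ‖p - τ • q‖ ^ 2 ≤ (1 - 2 * τ * κ + τ ^ 2 * L ^ 2) * ‖p‖ ^ 2 := by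
  have hq : ‖q‖ ^ 2 ≤ L ^ 2 * ‖p‖ ^ 2 := by rw [← mul_pow]; gcongr
  rw [norm_sub_sq_real, real_inner_smul_right, norm_smul, Real.norm_of_nonneg hτ,
    real_inner_comm]
  nlinarith [mul_le_mul_of_nonneg_left hκ hτ, mul_le_mul_of_nonneg_left hq (sq_nonneg τ)]

-- The solution is the fixed point of the contraction `u ↦ proj_K (u - τ T u)`, `τ = κ / (L + 1)²`.
theorem exists_isVISol_of_strongly_monotone [CompleteSpace E] (hK : Convex ℝ K) (hc : IsClosed K)
    (hne : K.Nonempty) {L : NNReal} (hL : LipschitzOnWith L T K) {κ : ℝ} (hκ : 0 < κ)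
    (hT : ∀ u ∈ K, ∀ v ∈ K, κ * ‖u - v‖ ^ 2 ≤ inner ℝ (T u - T v) (u - v)) :
    ∃ y, IsVISol K T y := by
  choose proj hproj using exists_isVISol_sub hK hc hne
  set τ : ℝ := κ / (L + 1) ^ 2
  set q : ℝ := 1 - κ ^ 2 / (L + 1) ^ 2
  have hτ : 0 < τ := by positivity
  have hcontr : ∀ u ∈ K, ∀ v ∈ K, ‖proj (u - τ • T u) - proj (v - τ • T v)‖ ≤ √q * ‖u - v‖ := by
    intro u hu v hv
    refine ((hproj _).norm_sub_le_of_sub (hproj _)).trans ?_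
    rw [← Real.sqrt_sq (norm_nonneg (u - v)), ← Real.sqrt_mul' _ (sq_nonneg _)]
    apply Real.le_sqrt_of_sq_le
    calc ‖(u - τ • T u) - (v - τ • T v)‖ ^ 2 = ‖(u - v) - τ • (T u - T v)‖ ^ 2 := by
          rw [smul_sub]; congr 2; abel
      _ ≤ (1 - 2 * τ * κ + τ ^ 2 * (L + 1) ^ 2) * ‖u - v‖ ^ 2 := by
          refine norm_sub_smul_sq_le hτ.le (hT u hu v hv) ((hL.norm_sub_le hu hv).trans ?_)
          gcongr; linarith
      _ = q * ‖u - v‖ ^ 2 := by simp only [τ, q]; field_simp; ring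
  have hq : (√q).toNNReal < 1 := by
    rw [Real.toNNReal_lt_one, Real.sqrt_lt' one_pos, one_pow]
    exact sub_lt_self _ (by positivity)
  have : CompleteSpace K := hc.completeSpace_coe
  have : Nonempty K := hne.to_subtype
  have hf : ContractingWith (√q).toNNReal fun u : K =>
      (⟨proj (u - τ • T u), (hproj _).1⟩ : K) := by
    refine ⟨hq, LipschitzWith.of_dist_le_mul fun u v => ?_⟩
    simpa only [Real.coe_toNNReal _ (Real.sqrt_nonneg _), Subtype.dist_eq, dist_eq_norm]
      using hcontr u u.2 v v.2
  have hfix := congrArg Subtype.val hf.fixedPoint_isFixedPt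
  refine ⟨hf.fixedPoint, (isVISol_sub_sub_smul_iff hτ).1 ?_⟩
  convert hproj _
  exact hfix.symm

theorem IsMonotoneMapOn.exists_isVISol_regularize [CompleteSpace E] (hT : IsMonotoneMapOn T K)
    (hK : Convex ℝ K) (hc : IsClosed K) (hne : K.Nonempty) {L : NNReal}
    (hL : LipschitzOnWith L T K) {ε : ℝ} (hε : 0 < ε) : ∃ y, IsVISol K (regularize T ε) y := by
  have hsub : ∀ u v, regularize T ε u - regularize T ε v = (T u - T v) + ε • (u - v) := by
    intro u v; simp only [regularize, smul_sub]; abel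
  have hlip : LipschitzOnWith (L + ε.toNNReal) (regularize T ε) K := by
    refine LipschitzOnWith.of_dist_le_mul fun u hu v hv => ?_
    rw [dist_eq_norm, dist_eq_norm, hsub, NNReal.coe_add, Real.coe_toNNReal _ hε.le, add_mul]
    refine (norm_add_le _ _).trans (add_le_add (hL.norm_sub_le hu hv) ?_)
    rw [norm_smul, Real.norm_of_nonneg hε.le]
  refine exists_isVISol_of_strongly_monotone hK hc hne hlip hε fun u hu v hv => ?_
  rw [hsub, inner_add_left, real_inner_smul_left, real_inner_self_eq_norm_sq]
  linarith [hT u hu v hv]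

theorem IsMonotoneMapOn.mul_inner_le_mul_inner (hT : IsMonotoneMapOn T K) {u v : E} {ε δ : ℝ}
    (hu : IsVISol K (regularize T ε) u) (hv : IsVISol K (regularize T δ) v) :
    δ * inner ℝ v (v - u) ≤ ε * inner ℝ u (v - u) := by
  have hTuv := hT u hu.1 v hv.1
  have hu' := hu.2 v hv.1
  have hv' := hv.2 u hu.1
  rw [← neg_sub v u, inner_neg_right] at hTuv hv'
  rw [inner_sub_left] at hTuv
  rw [regularize, inner_add_left, real_inner_smul_left] at hu' hv'
  linarith

theorem IsMonotoneMapOn.norm_sub_le (hT : IsMonotoneMapOn T K) {u v : E} {ε δ : ℝ} (hε : 0 < ε)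
    (hu : IsVISol K (regularize T ε) u) (hv : IsVISol K (regularize T δ) v) :
    ‖v - u‖ ≤ |ε - δ| / ε * ‖v‖ := by
  have h := hT.mul_inner_le_mul_inner hu hv
  have hsplit : inner ℝ u (v - u) = inner ℝ v (v - u) - ‖v - u‖ * ‖v - u‖ := by
    rw [← real_inner_self_eq_norm_mul_norm, ← inner_sub_left, sub_sub_cancel]
  have hmul : ε * (‖v - u‖ * ‖v - u‖) ≤ |ε - δ| * (‖v‖ * ‖v - u‖) := by
    calc ε * (‖v - u‖ * ‖v - u‖) ≤ (ε - δ) * inner ℝ v (v - u) := by rw [hsplit] at h; linarith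
      _ ≤ |ε - δ| * |inner ℝ v (v - u)| := by rw [← abs_mul]; exact le_abs_self _
      _ ≤ |ε - δ| * (‖v‖ * ‖v - u‖) := by gcongr; exact abs_real_inner_le_norm _ _
  rcases (norm_nonneg (v - u)).eq_or_lt with h0 | h0
  · rw [← h0]; positivity
  · rw [div_mul_eq_mul_div, le_div_iff₀ hε]
    exact le_of_mul_le_mul_right (by linarith) h0

theorem IsMonotoneMapOn.norm_sub_sq_le (hT : IsMonotoneMapOn T K) {u v : E} {ε δ : ℝ}
    (hδ : 0 ≤ δ) (hδε : δ < ε) (hu : IsVISol K (regularize T ε) u)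
    (hv : IsVISol K (regularize T δ) v) : ‖v - u‖ ^ 2 ≤ ‖v‖ ^ 2 - ‖u‖ ^ 2 := by
  have h := hT.mul_inner_le_mul_inner hu hv
  have hsplit : inner ℝ v (v - u) = inner ℝ u (v - u) + ‖v - u‖ ^ 2 := by
    rw [← real_inner_self_eq_norm_sq, ← inner_add_left, add_sub_cancel]
  have hexpand : ‖v‖ ^ 2 = ‖u‖ ^ 2 + 2 * inner ℝ u (v - u) + ‖v - u‖ ^ 2 := by
    rw [← norm_add_sq_real, add_sub_cancel]
  have hinner : 0 ≤ (ε - δ) * inner ℝ u (v - u) := by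
    rw [hsplit] at h
    linarith [mul_nonneg hδ (sq_nonneg ‖v - u‖)]
  linarith [nonneg_of_mul_nonneg_right hinner (sub_pos.2 hδε)]

theorem IsMonotoneMapOn.norm_le_of_isVISol (hT : IsMonotoneMapOn T K) {y b : E} {ε : ℝ}
    (hε : 0 < ε) (hy : IsVISol K (regularize T ε) y) (hb : IsVISol K T b) : ‖y‖ ≤ ‖b‖ := by
  have hb₀ : IsVISol K (regularize T 0) b := by
    simpa only [IsVISol, regularize, zero_smul, add_zero] using hb
  refine le_of_sq_le_sq ?_ (norm_nonneg b)
  linarith [hT.norm_sub_sq_le le_rfl hε hy hb₀, sq_nonneg ‖b - y‖]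

theorem IsMonotoneMapOn.cauchy_map_regularize (hT : IsMonotoneMapOn T K) {s : E}
    (hs : IsVISol K T s) {y : ℝ → E} (hy : ∀ ε > 0, IsVISol K (regularize T ε) (y ε)) :
    Cauchy (map y (𝓝[>] 0)) := by
  let S : Set ℝ := (fun ε => ‖y ε‖ ^ 2) '' Set.Ioi 0
  have hbdd : BddAbove S := by
    refine ⟨‖s‖ ^ 2, ?_⟩
    rintro _ ⟨ε, hε, rfl⟩
    exact pow_le_pow_left₀ (norm_nonneg _) (hT.norm_le_of_isVISol hε (hy ε hε) hs) 2
  have hne : S.Nonempty := ⟨_, 1, Set.mem_Ioi.2 one_pos, rfl⟩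
  refine Metric.cauchy_iff.2 ⟨inferInstance, fun r hr => ?_⟩
  obtain ⟨_, ⟨δ, hδ, rfl⟩, hlt⟩ :=
    exists_lt_of_lt_csSup hne (sub_lt_self _ (sq_pos_of_pos (half_pos hr)))
  have hclose : ∀ ε ∈ Set.Ioo 0 δ, dist (y ε) (y δ) < r / 2 := by
    intro ε hε
    have hle : ‖y ε‖ ^ 2 ≤ sSup S := le_csSup hbdd ⟨ε, hε.1, rfl⟩
    have := hT.norm_sub_sq_le hε.1.le hε.2 (hy δ hδ) (hy ε hε.1)
    rw [dist_eq_norm]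
    exact lt_of_pow_lt_pow_left₀ 2 (half_pos hr).le (by linarith)
  refine ⟨y '' Set.Ioo 0 δ, image_mem_map (Ioo_mem_nhdsGT hδ), ?_⟩
  rintro _ ⟨ε, hε, rfl⟩ _ ⟨ε', hε', rfl⟩
  linarith [dist_triangle_right (y ε) (y ε') (y δ), hclose ε hε, hclose ε' hε']

theorem IsMonotoneMapOn.exists_tendsto_regularize [CompleteSpace E] (hT : IsMonotoneMapOn T K)
    (hc : IsClosed K) (hcont : ContinuousOn T K) (hsol : ∃ s, IsVISol K T s) {y : ℝ → E}
    (hy : ∀ ε > 0, IsVISol K (regularize T ε) (y ε)) :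
    ∃ a, IsVISol K T a ∧ (∀ b, IsVISol K T b → ‖a‖ ≤ ‖b‖) ∧ Tendsto y (𝓝[>] 0) (𝓝 a) := by
  obtain ⟨s, hs⟩ := hsol
  obtain ⟨a, ha : Tendsto y (𝓝[>] 0) (𝓝 a)⟩ :=
    CompleteSpace.complete (hT.cauchy_map_regularize hs hy)
  have hmem : ∀ᶠ ε in 𝓝[>] 0, y ε ∈ K := eventually_mem_nhdsWithin.mono fun ε hε => (hy ε hε).1
  have haK : a ∈ K := hc.mem_of_tendsto ha hmem
  have hTa : Tendsto (fun ε => T (y ε)) (𝓝[>] 0) (𝓝 (T a)) :=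
    (hcont a haK).tendsto.comp (tendsto_nhdsWithin_iff.2 ⟨ha, hmem⟩)
  have hreg : Tendsto (fun ε => regularize T ε (y ε)) (𝓝[>] 0) (𝓝 (T a)) := by
    have := hTa.add ((tendsto_id.mono_left nhdsWithin_le_nhds).smul ha)
    rwa [zero_smul, add_zero] at this
  refine ⟨a, ⟨haK, fun z hz => ?_⟩, fun b hb => ?_, ha⟩
  · exact ge_of_tendsto (hreg.inner (tendsto_const_nhds.sub ha))
      (eventually_mem_nhdsWithin.mono fun ε hε => (hy ε hε).2 z hz)
  · exact le_of_tendsto ha.norm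
      (eventually_mem_nhdsWithin.mono fun ε hε => hT.norm_le_of_isVISol hε (hy ε hε) hb)

end VariationalInequality

section FirstOrderConvexity

variable {E : Type*} [NormedAddCommGroup E] [InnerProductSpace ℝ E] [CompleteSpace E]
  {f : E → ℝ} {g x z : E}

theorem inner_gradient_le_of_convexOn (hf : ConvexOn ℝ Set.univ f) (h : HasGradientAt f g x) :
    inner ℝ g (z - x) ≤ f z - f x := by
  refine le_of_tendsto (h.hasFDerivAt.hasLineDerivAt (z - x)).tendsto_slope_zero_right ?_
  filter_upwards [Ioc_mem_nhdsGT (zero_lt_one' ℝ)] with t ht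
  have hconv := hf.2 (Set.mem_univ x) (Set.mem_univ z) (sub_nonneg.2 ht.2) ht.1.le (by ring)
  rw [show (1 - t) • x + t • z = x + t • (z - x) by module] at hconv
  simp only [smul_eq_mul] at hconv ⊢
  rw [inv_mul_le_iff₀ ht.1]
  linarith

theorem inner_gradient_nonneg_of_isMinOn {K : Set E} (hK : Convex ℝ K) (h : HasGradientAt f g x)
    (hx : x ∈ K) (hmin : IsMinOn f K x) (hz : z ∈ K) : 0 ≤ inner ℝ g (z - x) :=
  hmin.localize.hasFDerivWithinAt_nonneg h.hasFDerivAt.hasFDerivWithinAt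
    (sub_mem_posTangentConeAt_of_segment_subset (hK.segment_subset hx hz))

end FirstOrderConvexity

theorem exists_abs_le_mul_one_add_norm {E : Type*} [NormedAddCommGroup E] [ProperSpace E]
    {f : E → ℝ} (hf : Continuous f) (hO : f =O[Bornology.cobounded E] fun a => ‖a‖) :
    ∃ B, 0 ≤ B ∧ ∀ a, |f a| ≤ B * (1 + ‖a‖) := by
  obtain ⟨c, hc, hO⟩ := hO.exists_nonneg
  obtain ⟨r, -, hr⟩ :=
    (Metric.hasBasis_cobounded_compl_closedBall (0 : E)).eventually_iff.1 hO.bound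
  obtain ⟨D, hD⟩ := (isCompact_closedBall (0 : E) r).exists_bound_of_continuousOn hf.continuousOn
  refine ⟨c + |D|, by positivity, fun a => ?_⟩
  rw [← Real.norm_eq_abs, show (c + |D|) * (1 + ‖a‖) = c + c * ‖a‖ + |D| + |D| * ‖a‖ by ring]
  have hnonneg : 0 ≤ c * ‖a‖ ∧ 0 ≤ |D| ∧ 0 ≤ |D| * ‖a‖ := by refine ⟨?_, ?_, ?_⟩ <;> positivity
  by_cases ha : a ∈ Metric.closedBall (0 : E) r
  · linarith [hD a ha, le_abs_self D]
  · have := hr ha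
    rw [norm_norm] at this
    linarith

section Replace

variable {N d : ℕ} {G : Game N d}

@[simp]
theorem Joint.replace_apply_self (a : Joint N d) (i : Fin N) (z : Action d) :
    a.replace i z i = z := by
  simp [Joint.replace]

theorem Joint.replace_apply_of_ne (a : Joint N d) {i j : Fin N} (h : j ≠ i) (z : Action d) :
    a.replace i z j = a j := by
  simp [Joint.replace, h]

@[simp]
theorem Joint.replace_self (a : Joint N d) (i : Fin N) : a.replace i (a i) = a := by
  simp [Joint.replace]

@[simp]
theorem Joint.replace_replace (a : Joint N d) (i : Fin N) (z w : Action d) :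
    (a.replace i z).replace i w = a.replace i w := by
  simp [Joint.replace]

theorem Joint.replace_mem {a : Joint N d} (ha : a ∈ G.jointSet) (i : Fin N) {z : Action d}
    (hz : z ∈ G.A i) : a.replace i z ∈ G.jointSet := by
  intro j
  rcases eq_or_ne j i with rfl | h
  · simpa using hz
  · simpa [Joint.replace_apply_of_ne _ h] using ha j

theorem Joint.inner_replace_sub (u a : Joint N d) (i : Fin N) (z : Action d) :
    inner ℝ u (a.replace i z - a) = inner ℝ (u i) (z - a i) := by
  rw [PiLp.inner_apply, Finset.sum_eq_single i]
  · simp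
  · intro j _ hj
    simp [Joint.replace_apply_of_ne _ hj]
  · simp

theorem Joint.contDiff_replace (a : Joint N d) (i : Fin N) : ContDiff ℝ 1 (a.replace i) :=
  PiLp.contDiff_toLp.comp (contDiff_update 1 a.ofLp i)

theorem Joint.continuous_replace_left (i : Fin N) (z : Action d) :
    Continuous fun a : Joint N d => a.replace i z :=
  (PiLp.continuous_toLp 2 _).comp ((PiLp.continuous_ofLp 2 _).update i continuous_const)

theorem Joint.norm_le_mul_of_forall_norm_apply_le {a b : Joint N d} {C : ℝ} (hC : 0 ≤ C)
    (h : ∀ i, ‖a i‖ ≤ C * ‖b i‖) : ‖a‖ ≤ C * ‖b‖ := by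
  refine le_of_sq_le_sq ?_ (by positivity)
  rw [mul_pow, PiLp.norm_sq_eq_of_L2, PiLp.norm_sq_eq_of_L2, Finset.mul_sum]
  refine Finset.sum_le_sum fun i _ => ?_
  rw [← mul_pow]
  exact pow_le_pow_left₀ (norm_nonneg _) (h i) 2

theorem Joint.norm_replace_sub_le {m a : Joint N d} {i : Fin N} {z : Action d}
    (hz : ‖z - m i‖ ≤ ‖a i - m i‖) : ‖a.replace i z - m‖ ≤ ‖a - m‖ := by
  rw [← one_mul ‖a - m‖]
  refine Joint.norm_le_mul_of_forall_norm_apply_le zero_le_one fun j => ?_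
  rcases eq_or_ne j i with rfl | hj
  · simpa using hz
  · simp [Joint.replace_apply_of_ne _ hj]

end Replace

section GameMapping

variable {N d : ℕ} {G : Game N d}

theorem Game.IsConvex.convex_jointSet (hG : G.IsConvex) : Convex ℝ G.jointSet :=
  fun _ hx _ hy _ _ ha hb hab i => hG.convex_set i (hx i) (hy i) ha hb hab

theorem Game.IsConvex.isClosed_jointSet (hG : G.IsConvex) : IsClosed G.jointSet := by
  rw [Game.jointSet, Set.ofPred_forall]
  exact isClosed_iInter fun i => (hG.closed_set i).preimage (PiLp.continuous_apply 2 _ i)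

theorem Game.IsConvex.hasGradientAt_replace (hG : G.IsConvex) (i : Fin N) (a : Joint N d)
    (z : Action d) :
    HasGradientAt (fun w => G.J i (a.replace i w)) (G.mapping (a.replace i z) i) z := by
  have h : DifferentiableAt ℝ (fun w => G.J i (a.replace i w)) z :=
    ((hG.contDiff_cost i).comp (a.contDiff_replace i)).differentiable one_ne_zero z
  simpa [Game.mapping] using h.hasGradientAt

theorem Game.IsConvex.isNash_iff (hG : G.IsConvex) {a : Joint N d} :
    G.IsNash a ↔ IsVISol G.jointSet G.mapping a := by
  have hgrad (i : Fin N) :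
      HasGradientAt (fun w => G.J i (a.replace i w)) (G.mapping a i) (a i) := by
    simpa using hG.hasGradientAt_replace i a (a i)
  refine and_congr_right fun ha => ⟨fun hmin z hz => ?_, fun hvi i z hz => ?_⟩
  · rw [PiLp.inner_apply]
    exact Finset.sum_nonneg fun i _ => inner_gradient_nonneg_of_isMinOn (hG.convex_set i) (hgrad i)
      (ha i) (fun w hw => by simpa using hmin i w hw) (hz i)
  · have h := hvi _ (Joint.replace_mem ha i hz)
    rw [Joint.inner_replace_sub] at h
    simpa using h.trans (inner_gradient_le_of_convexOn (hG.convex_cost i a) (hgrad i))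

theorem Game.LipschitzMapping.exists_lipschitzWith (h : G.LipschitzMapping) :
    ∃ L, LipschitzWith L G.mapping := by
  choose l hl using h
  have hpi : LipschitzWith (Finset.univ.sup l) fun a i => G.mapping a i := fun u v =>
    edist_pi_le_iff.2 fun i => (hl i).weaken (Finset.le_sup (Finset.mem_univ i)) u v
  exact ⟨_, (PiLp.lipschitzWith_toLp 2 _).comp hpi⟩

theorem Game.LinearGrowth.exists_abs_le (h : G.LinearGrowth) (hG : G.IsConvex) :
    ∃ B, 0 ≤ B ∧ ∀ i a, |G.J i a| ≤ B * (1 + ‖a‖) := by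
  choose B hB0 hB using fun i =>
    exists_abs_le_mul_one_add_norm (hG.contDiff_cost i).continuous (h i)
  refine ⟨∑ i, B i, Finset.sum_nonneg fun i _ => hB0 i, fun i a => (hB i a).trans ?_⟩
  gcongr
  exact Finset.single_le_sum (fun j _ => hB0 j) (Finset.mem_univ i)

theorem Game.IsConvex.abs_sub_replace_sub_inner_le (hG : G.IsConvex) {L : NNReal}
    (hL : LipschitzWith L G.mapping) (m h : Joint N d) (i : Fin N) :
    |G.J i (m + h) - G.J i ((m + h).replace i (m i)) - inner ℝ (G.mapping m i) (h i)|
      ≤ L * ‖h‖ * ‖h i‖ := by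
  have key := (convex_closedBall (m i) ‖h i‖).norm_image_sub_le_of_norm_hasFDerivWithin_le'
    (φ := InnerProductSpace.toDual ℝ (Action d) (G.mapping m i)) (C := L * ‖h‖)
    (fun z _ => (hG.hasGradientAt_replace i (m + h) z).hasFDerivAt.hasFDerivWithinAt) ?_
    (Metric.mem_closedBall_self (norm_nonneg _)) (y := (m + h) i) (by simp)
  · rw [Joint.replace_self] at key
    simpa using key
  · intro z hz
    rw [← map_sub, LinearIsometryEquiv.norm_map, ← PiLp.sub_apply]
    refine (PiLp.norm_apply_le _ i).trans ((hL.norm_sub_le _ _).trans ?_)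
    gcongr
    simpa using Joint.norm_replace_sub_le (m := m) (a := m + h) (i := i) (z := z)
      (by simpa [dist_eq_norm] using hz)

end GameMapping

section StdGaussian

variable {E F : Type*} [NormedAddCommGroup E] [InnerProductSpace ℝ E] [FiniteDimensional ℝ E]
  [MeasurableSpace E] [BorelSpace E] [NormedAddCommGroup F] [NormedSpace ℝ F]

theorem integrable_norm_pow_stdGaussian (k : ℕ) :
    Integrable (fun z : E => ‖z‖ ^ k) (stdGaussian E) := by
  rcases k with _ | k
  · simp
  · exact (IsGaussian.memLp_id (stdGaussian E) ((k + 1 : ℕ) : ENNReal)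
      (by simp)).integrable_norm_pow (by simp)

theorem integrable_inner_smul_stdGaussian (u : E) :
    Integrable (fun z => inner ℝ u z • z) (stdGaussian E) := by
  refine ((integrable_norm_pow_stdGaussian 2).const_mul ‖u‖).mono' (by fun_prop)
    (ae_of_all _ fun z => ?_)
  rw [norm_smul, pow_two, ← mul_assoc]
  gcongr
  exact norm_inner_le_norm u z

theorem integral_inner_smul_stdGaussian (u : E) :
    ∫ z, inner ℝ u z • z ∂(stdGaussian E) = u := by
  refine ext_inner_left ℝ fun v => ?_
  have hcov := covarianceBilin_apply (μ := stdGaussian E) (IsGaussian.memLp_id _ 2 (by simp)) u v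
  rw [covarianceBilin_stdGaussian] at hcov
  rw [← integral_inner (integrable_inner_smul_stdGaussian u), real_inner_comm]
  simpa [real_inner_smul_right, innerSL_apply_apply ℝ] using hcov.symm

theorem integral_stdGaussian_eq_zero_of_comp_eq_neg (e : E ≃ₗᵢ[ℝ] E) {f : E → F}
    (hf : ∀ z, f (e z) = -f z) : ∫ z, f z ∂(stdGaussian E) = 0 := by
  have hinv : ∫ z, f z ∂(stdGaussian E) = ∫ z, f (e z) ∂(stdGaussian E) := by
    conv_lhs => rw [← stdGaussian_map e]
    exact e.toHomeomorph.measurableEmbedding.integral_map f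
  simp_rw [hf, integral_neg] at hinv
  have := IsAddTorsionFree.of_isTorsionFree ℝ F
  exact self_eq_neg.1 hinv

end StdGaussian

section BlockScale

variable {N d : ℕ}

/-- Multiplication of the block of each player `i` by the scalar `c i`. -/
noncomputable def blockScale (c : Fin N → ℝ) (z : Joint N d) : Joint N d :=
  WithLp.toLp 2 fun i => c i • z i

/-- The reflection of `ℝ^{Nd}` that changes the sign of the block of player `i`. -/
noncomputable def blockFlip (i : Fin N) : Joint N d ≃ₗᵢ[ℝ] Joint N d :=
  LinearIsometryEquiv.piLpCongrRight 2
    fun j => if j = i then LinearIsometryEquiv.neg ℝ else LinearIsometryEquiv.refl ℝ _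

theorem blockFlip_apply_self (i : Fin N) (z : Joint N d) : blockFlip i z i = -z i := by
  simp [blockFlip]

theorem blockFlip_apply_of_ne {i j : Fin N} (h : j ≠ i) (z : Joint N d) :
    blockFlip i z j = z j := by
  simp [blockFlip, h]

theorem norm_blockScale_le {c : Fin N → ℝ} {C : ℝ} (hC : 0 ≤ C) (hc : ∀ i, |c i| ≤ C)
    (z : Joint N d) : ‖blockScale c z‖ ≤ C * ‖z‖ := by
  refine Joint.norm_le_mul_of_forall_norm_apply_le hC fun i => ?_
  rw [blockScale, norm_smul]
  gcongr
  exact hc i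

theorem blockScale_sub (c c' : Fin N → ℝ) (z : Joint N d) :
    blockScale c z - blockScale c' z = blockScale (c - c') z := by
  ext1 i
  simp only [blockScale, PiLp.sub_apply, Pi.sub_apply, sub_smul]

theorem continuous_blockScale {c : Joint N d → Fin N → ℝ} (hc : ∀ i, Continuous fun z => c z i) :
    Continuous fun z => blockScale (c z) z :=
  (PiLp.continuous_toLp 2 _).comp
    (continuous_pi fun i => (hc i).smul (PiLp.continuous_apply 2 _ i))

theorem norm_sq_blockScale_le {c : Fin N → ℝ} {A D : ℝ} (hA : 0 ≤ A) (hD : 0 ≤ D) {z : Joint N d}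
    (hc : ∀ i, |c i| ≤ A + D * ‖z‖) :
    ‖blockScale c z‖ ^ 2 ≤ 2 * A ^ 2 * ‖z‖ ^ 2 + 2 * D ^ 2 * ‖z‖ ^ 4 := by
  calc ‖blockScale c z‖ ^ 2 ≤ ((A + D * ‖z‖) * ‖z‖) ^ 2 := by
        gcongr; exact norm_blockScale_le (by positivity) hc z
    _ = (A + D * ‖z‖) ^ 2 * ‖z‖ ^ 2 := mul_pow _ _ _
    _ ≤ (2 * (A ^ 2 + (D * ‖z‖) ^ 2)) * ‖z‖ ^ 2 := by gcongr; exact add_sq_le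
    _ = 2 * A ^ 2 * ‖z‖ ^ 2 + 2 * D ^ 2 * ‖z‖ ^ 4 := by ring

variable {c : Joint N d → Fin N → ℝ}

theorem memLp_two_blockScale (hcont : ∀ i, Continuous fun z => c z i) {A D : ℝ} (hA : 0 ≤ A)
    (hD : 0 ≤ D) (hc : ∀ z i, |c z i| ≤ A + D * ‖z‖) :
    MemLp (fun z => blockScale (c z) z) 2 (stdGaussian (Joint N d)) := by
  have hmeas := (continuous_blockScale hcont).aestronglyMeasurable
    (μ := stdGaussian (Joint N d))
  rw [memLp_two_iff_integrable_sq_norm hmeas]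
  refine (((integrable_norm_pow_stdGaussian 2).const_mul (2 * A ^ 2)).add
    ((integrable_norm_pow_stdGaussian 4).const_mul (2 * D ^ 2))).mono' (hmeas.norm.pow 2)
    (ae_of_all _ fun z => ?_)
  rw [Real.norm_of_nonneg (by positivity)]
  exact norm_sq_blockScale_le hA hD (hc z)

theorem integral_norm_sq_blockScale_le {A D : ℝ} (hA : 0 ≤ A) (hD : 0 ≤ D)
    (hc : ∀ z i, |c z i| ≤ A + D * ‖z‖) :
    ∫ z, ‖blockScale (c z) z‖ ^ 2 ∂(stdGaussian (Joint N d)) ≤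
      2 * A ^ 2 * ∫ z, ‖z‖ ^ 2 ∂(stdGaussian (Joint N d)) +
      2 * D ^ 2 * ∫ z, ‖z‖ ^ 4 ∂(stdGaussian (Joint N d)) := by
  have h2 : Integrable (fun z : Joint N d => ‖z‖ ^ 2) (stdGaussian (Joint N d)) :=
    integrable_norm_pow_stdGaussian 2
  have h4 : Integrable (fun z : Joint N d => ‖z‖ ^ 4) (stdGaussian (Joint N d)) :=
    integrable_norm_pow_stdGaussian 4
  rw [← integral_const_mul, ← integral_const_mul, ← integral_add (h2.const_mul _) (h4.const_mul _)]
  exact integral_mono_of_nonneg (ae_of_all _ fun z => by positivity)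
    ((h2.const_mul _).add (h4.const_mul _))
    (ae_of_all _ fun z => norm_sq_blockScale_le hA hD (hc z))

theorem integral_apply_joint {f : Joint N d → Joint N d} {ν : Measure (Joint N d)}
    (hf : Integrable f ν) (i : Fin N) : (∫ z, f z ∂ν) i = ∫ z, f z i ∂ν :=
  ((PiLp.proj 2 (fun _ : Fin N => Action d) i : Joint N d →L[ℝ] Action d).integral_comp_comm
    hf).symm

theorem integral_blockScale_eq_zero
    (hint : Integrable (fun z => blockScale (c z) z) (stdGaussian (Joint N d)))
    (hc : ∀ i z, c (blockFlip i z) i = c z i) :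
    ∫ z, blockScale (c z) z ∂(stdGaussian (Joint N d)) = 0 := by
  ext1 i
  rw [integral_apply_joint hint]
  refine integral_stdGaussian_eq_zero_of_comp_eq_neg (blockFlip i) fun z => ?_
  simp only [blockScale, hc, blockFlip_apply_self, smul_neg]

theorem integrable_blockScale_inner (u : Joint N d) :
    Integrable (fun z => blockScale (fun i => inner ℝ (u i) (z i)) z)
      (stdGaussian (Joint N d)) := by
  refine (memLp_two_blockScale (fun i => by fun_prop) le_rfl (norm_nonneg u)
    fun z i => ?_).integrable one_le_two
  rw [zero_add]
  exact (abs_real_inner_le_norm _ _).trans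
    (mul_le_mul (PiLp.norm_apply_le _ i) (PiLp.norm_apply_le _ i) (norm_nonneg _) (norm_nonneg _))

theorem integral_blockScale_inner (u : Joint N d) :
    ∫ z, blockScale (fun i => inner ℝ (u i) (z i)) z ∂(stdGaussian (Joint N d)) = u := by
  ext1 i
  let uᵢ : Joint N d := Joint.replace 0 i (u i)
  have huᵢ : ∀ z, inner ℝ uᵢ z = inner ℝ (u i) (z i) := fun z => by
    simpa [uᵢ, real_inner_comm] using Joint.inner_replace_sub z 0 i (u i)
  have hcoord := integral_apply_joint (integrable_inner_smul_stdGaussian uᵢ) i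
  rw [integral_inner_smul_stdGaussian] at hcoord
  rw [integral_apply_joint (integrable_blockScale_inner u)]
  simpa [uᵢ, blockScale, huᵢ] using hcoord.symm

end BlockScale

section Estimate

variable {N d : ℕ} {G : Game N d}

/-- The payoff-based estimate `(J_i(x) (x^i - m^i) / s²)_i` of the game mapping at `m`, computed
from the joint action `x` played around `m` with standard deviation `s`. -/
noncomputable def Game.estimate (G : Game N d) (s : ℝ) (m x : Joint N d) : Joint N d :=
  WithLp.toLp 2 fun i => (G.J i x / s ^ 2) • (x i - m i)

theorem Game.estimate_add_smul (G : Game N d) (s : ℝ) (m z : Joint N d) :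
    G.estimate s m (m + s • z) = blockScale (fun i => G.J i (m + s • z) / s) z := by
  ext1 i
  simp only [Game.estimate, blockScale, PiLp.add_apply, PiLp.smul_apply, add_sub_cancel_left,
    smul_smul]
  congr 1
  field_simp

theorem abs_div_le_of_growth {E : Type*} [NormedAddCommGroup E] [NormedSpace ℝ E] {f : E → ℝ}
    {B : ℝ} (hB : 0 ≤ B) (hf : ∀ a, |f a| ≤ B * (1 + ‖a‖)) {s : ℝ} (hs : 0 < s) {a m z : E}
    (ha : ‖a - m‖ ≤ ‖s • z‖) : |f a / s| ≤ B * (1 + ‖m‖) / s + B * ‖z‖ := by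
  rw [norm_smul, Real.norm_of_nonneg hs.le] at ha
  rw [abs_div, abs_of_pos hs, div_le_iff₀ hs, add_mul, div_mul_cancel₀ _ hs.ne']
  calc |f a| ≤ B * (1 + ‖a‖) := hf a
    _ ≤ B * (1 + (‖m‖ + s * ‖z‖)) := by gcongr; linarith [norm_le_norm_add_norm_sub' a m]
    _ = B * (1 + ‖m‖) + B * ‖z‖ * s := by ring

theorem Game.abs_cost_div_le {B : ℝ} (hB : 0 ≤ B) (hJ : ∀ i a, |G.J i a| ≤ B * (1 + ‖a‖)) {s : ℝ}
    (hs : 0 < s) (m z : Joint N d) (i : Fin N) :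
    |G.J i (m + s • z) / s| ≤ B * (1 + ‖m‖) / s + B * ‖z‖ :=
  abs_div_le_of_growth hB (hJ i) hs (by simp)

theorem Game.abs_cost_replace_div_le {B : ℝ} (hB : 0 ≤ B) (hJ : ∀ i a, |G.J i a| ≤ B * (1 + ‖a‖))
    {s : ℝ} (hs : 0 < s) (m z : Joint N d) (i : Fin N) :
    |G.J i ((m + s • z).replace i (m i)) / s| ≤ B * (1 + ‖m‖) / s + B * ‖z‖ :=
  abs_div_le_of_growth hB (hJ i) hs
    ((Joint.norm_replace_sub_le (by simp)).trans_eq (by rw [add_sub_cancel_left]))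

theorem Game.memLp_estimate (hG : G.IsConvex) (hgrowth : G.LinearGrowth) {s : ℝ} (hs : 0 < s)
    (m : Joint N d) :
    MemLp (fun z => G.estimate s m (m + s • z)) 2 (stdGaussian (Joint N d)) := by
  obtain ⟨B, hB, hJ⟩ := hgrowth.exists_abs_le hG
  simp only [Game.estimate_add_smul]
  refine memLp_two_blockScale (fun i => ?_) (by positivity) hB
    fun z i => Game.abs_cost_div_le hB hJ hs m z i
  have := (hG.contDiff_cost i).continuous
  fun_prop

theorem Game.LinearGrowth.exists_integral_norm_sq_estimate_le (hgrowth : G.LinearGrowth)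
    (hG : G.IsConvex) (S : ℝ) :
    ∃ C, 0 ≤ C ∧ ∀ s, 0 < s → s ≤ S → ∀ m,
      ∫ z, ‖G.estimate s m (m + s • z)‖ ^ 2 ∂(stdGaussian (Joint N d)) ≤
        C / s ^ 2 * (1 + ‖m‖ ^ 2) := by
  obtain ⟨B, hB, hJ⟩ := hgrowth.exists_abs_le hG
  set I₂ := ∫ z, ‖z‖ ^ 2 ∂(stdGaussian (Joint N d))
  set I₄ := ∫ z, ‖z‖ ^ 4 ∂(stdGaussian (Joint N d))
  have : 0 ≤ I₂ := integral_nonneg fun z => by positivity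
  have : 0 ≤ I₄ := integral_nonneg fun z => by positivity
  refine ⟨4 * B ^ 2 * I₂ + 2 * B ^ 2 * S ^ 2 * I₄, by positivity, fun s hs hsS m => ?_⟩
  simp only [Game.estimate_add_smul]
  have hm : (1 + ‖m‖) ^ 2 ≤ 2 * (1 + ‖m‖ ^ 2) := by simpa using add_sq_le (a := 1) (b := ‖m‖)
  have hs2 : 1 ≤ S ^ 2 / s ^ 2 * (1 + ‖m‖ ^ 2) := by
    refine one_le_mul_of_one_le_of_one_le ((one_le_div (by positivity)).2 (by gcongr)) ?_
    linarith [sq_nonneg ‖m‖]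
  calc _ ≤ 2 * (B * (1 + ‖m‖) / s) ^ 2 * I₂ + 2 * B ^ 2 * I₄ :=
        integral_norm_sq_blockScale_le (by positivity) hB
          fun z i => Game.abs_cost_div_le hB hJ hs m z i
    _ = 2 * B ^ 2 / s ^ 2 * (1 + ‖m‖) ^ 2 * I₂ + 2 * B ^ 2 * I₄ * 1 := by ring
    _ ≤ 2 * B ^ 2 / s ^ 2 * (2 * (1 + ‖m‖ ^ 2)) * I₂
        + 2 * B ^ 2 * I₄ * (S ^ 2 / s ^ 2 * (1 + ‖m‖ ^ 2)) := by gcongr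
    _ = (4 * B ^ 2 * I₂ + 2 * B ^ 2 * S ^ 2 * I₄) / s ^ 2 * (1 + ‖m‖ ^ 2) := by ring

/-- The estimate in which player `i` observes, instead of the cost of the joint action `m + s • z`,
its cost after resetting the own action to `m i`. Subtracting this baseline does not change the mean
of the estimate, as the cost observed does not depend on `z i`. -/
noncomputable def Game.baseline (G : Game N d) (s : ℝ) (m z : Joint N d) : Joint N d :=
  blockScale (fun i => G.J i ((m + s • z).replace i (m i)) / s) z

theorem Game.integrable_baseline (hG : G.IsConvex) (hgrowth : G.LinearGrowth) {s : ℝ} (hs : 0 < s)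
    (m : Joint N d) : Integrable (G.baseline s m) (stdGaussian (Joint N d)) := by
  obtain ⟨B, hB, hJ⟩ := hgrowth.exists_abs_le hG
  refine (memLp_two_blockScale (fun i => ?_) (by positivity) hB
    fun z i => Game.abs_cost_replace_div_le hB hJ hs m z i).integrable one_le_two
  exact ((hG.contDiff_cost i).continuous.comp
    ((Joint.continuous_replace_left i (m i)).comp (by fun_prop))).div_const s

theorem Game.integral_baseline (hG : G.IsConvex) (hgrowth : G.LinearGrowth) {s : ℝ} (hs : 0 < s)
    (m : Joint N d) : ∫ z, G.baseline s m z ∂(stdGaussian (Joint N d)) = 0 := by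
  refine integral_blockScale_eq_zero (Game.integrable_baseline hG hgrowth hs m) fun i z => ?_
  congr 2
  ext1 j
  rcases eq_or_ne j i with rfl | hj
  · simp
  · simp [Joint.replace_apply_of_ne _ hj, blockFlip_apply_of_ne hj]

theorem Game.norm_estimate_sub_baseline_sub_le (hG : G.IsConvex) {L : NNReal}
    (hL : LipschitzWith L G.mapping) {s : ℝ} (hs : 0 < s) (m z : Joint N d) :
    ‖G.estimate s m (m + s • z) - G.baseline s m z
      - blockScale (fun i => inner ℝ (G.mapping m i) (z i)) z‖ ≤ L * s * ‖z‖ ^ 3 := by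
  rw [Game.estimate_add_smul, Game.baseline, blockScale_sub, blockScale_sub, pow_succ, ← mul_assoc]
  refine norm_blockScale_le (by positivity) (fun i => ?_) z
  have htaylor := hG.abs_sub_replace_sub_inner_le hL m (s • z) i
  have hfactor (a b r : ℝ) : a / s - b / s - r = (a - b - s * r) / s := by field_simp
  rw [PiLp.smul_apply, real_inner_smul_right, norm_smul, norm_smul, Real.norm_of_nonneg hs.le]
    at htaylor
  simp only [Pi.sub_apply]
  rw [hfactor, abs_div, abs_of_pos hs, div_le_iff₀ hs]
  calc _ ≤ L * (s * ‖z‖) * (s * ‖z i‖) := htaylor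
    _ ≤ L * (s * ‖z‖) * (s * ‖z‖) := by gcongr; exact PiLp.norm_apply_le z i
    _ = L * s * ‖z‖ ^ 2 * s := by ring

theorem Game.norm_integral_estimate_sub_mapping_le (hG : G.IsConvex) (hgrowth : G.LinearGrowth)
    {L : NNReal} (hL : LipschitzWith L G.mapping) {s : ℝ} (hs : 0 < s) (m : Joint N d) :
    ‖(∫ z, G.estimate s m (m + s • z) ∂(stdGaussian (Joint N d))) - G.mapping m‖ ≤
      L * s * ∫ z, ‖z‖ ^ 3 ∂(stdGaussian (Joint N d)) := by
  have hest := (Game.memLp_estimate hG hgrowth hs m).integrable one_le_two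
  have hbase := Game.integrable_baseline hG hgrowth hs m
  have hmean : (∫ z, G.estimate s m (m + s • z) ∂(stdGaussian (Joint N d))) - G.mapping m =
      ∫ z, (G.estimate s m (m + s • z) - G.baseline s m z
        - blockScale (fun i => inner ℝ (G.mapping m i) (z i)) z) ∂(stdGaussian (Joint N d)) := by
    rw [integral_sub (f := fun z => _ - _) (hest.sub hbase) (integrable_blockScale_inner _),
      integral_sub hest hbase, Game.integral_baseline hG hgrowth hs, sub_zero,
      integral_blockScale_inner]
  rw [hmean, ← integral_const_mul]
  exact norm_integral_le_of_norm_le ((integrable_norm_pow_stdGaussian 3).const_mul _)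
    (ae_of_all _ fun z => Game.norm_estimate_sub_baseline_sub_le hG hL hs m z)

end Estimate

section StochasticStep

theorem norm_add_add_sq_le {F : Type*} [SeminormedAddCommGroup F] (a b c : F) :
    ‖a + b + c‖ ^ 2 ≤ 3 * (‖a‖ ^ 2 + ‖b‖ ^ 2 + ‖c‖ ^ 2) := by
  have h : ‖a + b + c‖ ^ 2 ≤ (‖a‖ + ‖b‖ + ‖c‖) ^ 2 := by gcongr; exact norm_add₃_le
  linarith [sq_nonneg (‖a‖ - ‖b‖), sq_nonneg (‖b‖ - ‖c‖), sq_nonneg (‖a‖ - ‖c‖)]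

theorem norm_apply_le_of_lipschitzWith {E F : Type*} [SeminormedAddCommGroup E]
    [SeminormedAddCommGroup F] {f : E → F} {L : NNReal} (hf : LipschitzWith L f) {y : E} {Y : ℝ}
    (hy : ‖y‖ ≤ Y) : ‖f y‖ ≤ ‖f 0‖ + L * Y := by
  calc ‖f y‖ ≤ ‖f 0‖ + ‖f y - f 0‖ := norm_le_norm_add_norm_sub' _ _
    _ ≤ ‖f 0‖ + L * ‖y - 0‖ := by gcongr; exact hf.norm_sub_le y 0
    _ ≤ ‖f 0‖ + L * Y := by rw [sub_zero]; gcongr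

variable {E : Type*} [NormedAddCommGroup E] [InnerProductSpace ℝ E]

theorem norm_step_sub_step_sq_le (m y g v : E) (β ε : ℝ) :
    ‖(m - β • (g + ε • m)) - (y - β • (v + ε • y))‖ ^ 2 ≤
      (1 - 2 * β * ε) * ‖m - y‖ ^ 2 - 2 * β * inner ℝ (m - y) (g - v)
        + 3 * β ^ 2 * (‖g‖ ^ 2 + ‖v‖ ^ 2 + ε ^ 2 * ‖m - y‖ ^ 2) := by
  have hsplit : (m - β • (g + ε • m)) - (y - β • (v + ε • y))
      = (m - y) - β • (g + -v + ε • (m - y)) := by module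
  have hsq := norm_add_add_sq_le g (-v) (ε • (m - y))
  rw [norm_neg, norm_smul, mul_pow, Real.norm_eq_abs, sq_abs] at hsq
  rw [hsplit, norm_sub_sq_real, real_inner_smul_right, inner_add_right, real_inner_smul_right,
    real_inner_self_eq_norm_sq, ← sub_eq_add_neg, norm_smul, mul_pow, Real.norm_eq_abs, sq_abs]
  rw [← sub_eq_add_neg] at hsq
  linarith [mul_le_mul_of_nonneg_left hsq (sq_nonneg β)]

theorem neg_mul_norm_le_inner_sub {g m u v y : E} {b : ℝ} (hbias : ‖g - u‖ ≤ b)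
    (hmono : 0 ≤ inner ℝ (u - v) (m - y)) : -(b * ‖m - y‖) ≤ inner ℝ (m - y) (g - v) := by
  have hb : -(b * ‖m - y‖) ≤ inner ℝ (g - u) (m - y) :=
    neg_le_of_neg_le ((neg_le_abs _).trans ((abs_real_inner_le_norm _ _).trans (by gcongr)))
  rw [real_inner_comm, ← sub_add_sub_cancel _ u v, inner_add_left]
  linarith

theorem one_add_norm_sq_le {F : Type*} [SeminormedAddCommGroup F] (m : F) {y : F} {Y : ℝ}
    (hy : ‖y‖ ≤ Y) : 1 + ‖m‖ ^ 2 ≤ (2 + 2 * Y ^ 2) * (1 + ‖m - y‖ ^ 2) := by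
  have hm : ‖m‖ ^ 2 ≤ (Y + ‖m - y‖) ^ 2 := by
    gcongr
    linarith [norm_le_norm_add_norm_sub' m y]
  linarith [add_sq_le (a := Y) (b := ‖m - y‖), mul_nonneg (sq_nonneg Y) (sq_nonneg ‖m - y‖)]

theorem integral_norm_step_sub_step_sq_le [CompleteSpace E] {Ω : Type*} [MeasurableSpace Ω]
    {ν : Measure Ω} [IsProbabilityMeasure ν] {g : Ω → E} (hg : MemLp g 2 ν) {m y u v : E}
    {b β ε : ℝ} (hβ : 0 ≤ β) (hbias : ‖(∫ z, g z ∂ν) - u‖ ≤ b)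
    (hmono : 0 ≤ inner ℝ (u - v) (m - y)) :
    ∫ z, ‖(m - β • (g z + ε • m)) - (y - β • (v + ε • y))‖ ^ 2 ∂ν ≤
      (1 - 2 * β * ε) * ‖m - y‖ ^ 2 + 2 * β * (b * ‖m - y‖)
        + 3 * β ^ 2 * ((∫ z, ‖g z‖ ^ 2 ∂ν) + ‖v‖ ^ 2 + ε ^ 2 * ‖m - y‖ ^ 2) := by
  have hint := hg.integrable one_le_two
  have : Integrable (fun z => inner ℝ (m - y) (g z - v)) ν :=
    (hint.sub (integrable_const v)).const_inner (m - y)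
  have hsq : Integrable (fun z => ‖g z‖ ^ 2) ν := hg.integrable_norm_pow two_ne_zero
  have hmean : ∫ z, inner ℝ (m - y) (g z - v) ∂ν = inner ℝ (m - y) ((∫ z, g z ∂ν) - v) := by
    rw [integral_inner (f := fun z => g z - v) (hint.sub (integrable_const v)),
      integral_sub hint (integrable_const v)]
    simp
  have hdrift := neg_mul_norm_le_inner_sub hbias hmono
  calc ∫ z, ‖(m - β • (g z + ε • m)) - (y - β • (v + ε • y))‖ ^ 2 ∂ν
      ≤ ∫ z, ((1 - 2 * β * ε) * ‖m - y‖ ^ 2 - 2 * β * inner ℝ (m - y) (g z - v)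
          + 3 * β ^ 2 * (‖g z‖ ^ 2 + ‖v‖ ^ 2 + ε ^ 2 * ‖m - y‖ ^ 2)) ∂ν :=
        integral_mono_of_nonneg (ae_of_all _ fun z => by positivity) (by fun_prop)
          (ae_of_all _ fun z => norm_step_sub_step_sq_le m y (g z) v β ε)
    _ = (1 - 2 * β * ε) * ‖m - y‖ ^ 2 - 2 * β * inner ℝ (m - y) ((∫ z, g z ∂ν) - v)
          + 3 * β ^ 2 * ((∫ z, ‖g z‖ ^ 2 ∂ν) + ‖v‖ ^ 2 + ε ^ 2 * ‖m - y‖ ^ 2) := by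
        rw [integral_add (by fun_prop) (by fun_prop), integral_sub (by fun_prop) (by fun_prop),
          integral_const_mul, integral_const_mul, integral_const_mul,
          integral_add (f := fun z => ‖g z‖ ^ 2 + ‖v‖ ^ 2) (by fun_prop) (by fun_prop),
          integral_add hsq (integrable_const _), hmean]
        simp
    _ ≤ _ := by linarith [mul_le_mul_of_nonneg_left hdrift (mul_nonneg zero_le_two hβ)]

end StochasticStep

section GameStep

variable {N d : ℕ} {G : Game N d}

/-- The step of the algorithm before projection, from the mean `m` when `x` has been played. -/
noncomputable def Game.step (G : Game N d) (γ s ε : ℝ) (m x : Joint N d) : Joint N d :=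
  m - (γ * s ^ 2) • (G.estimate s m x + ε • m)

theorem exists_integral_step_sq_le (hG : G.IsConvex) (hmono : IsMonotoneOver G.mapping G.jointSet)
    (hlip : G.LipschitzMapping) (hgrowth : G.LinearGrowth) (S Y : ℝ) :
    ∃ C, 0 ≤ C ∧ ∀ γ s ε : ℝ, 0 ≤ γ → 0 < s → s ≤ S → 0 ≤ ε → ε ≤ S →
      ∀ m ∈ G.jointSet, ∀ y ∈ G.jointSet, ‖y‖ ≤ Y →
        ∫ z, ‖G.step γ s ε m (m + s • z) - (y - (γ * s ^ 2) • regularize G.mapping ε y)‖ ^ 2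
            ∂(stdGaussian (Joint N d)) ≤
          (1 - 2 * (γ * s ^ 2) * ε) * ‖m - y‖ ^ 2
            + C * (γ * s ^ 2 * s + γ ^ 2) * (1 + ‖m - y‖ ^ 2) := by
  obtain ⟨L, hL⟩ := hlip.exists_lipschitzWith
  obtain ⟨C₂, hC₂, hsecond⟩ := hgrowth.exists_integral_norm_sq_estimate_le hG S
  set I₃ := ∫ z, ‖z‖ ^ 3 ∂(stdGaussian (Joint N d))
  have : 0 ≤ I₃ := integral_nonneg fun z => by positivity
  set V := ‖G.mapping 0‖ + L * Y
  set C₃ := 3 * (S ^ 2 * C₂ * (2 + 2 * Y ^ 2) + S ^ 4 * V ^ 2 + S ^ 4 * S ^ 2)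
  have : 0 ≤ C₃ := by positivity
  refine ⟨L * I₃ + C₃, by positivity, fun γ s ε hγ hs hsS hε hεS m hm y hy hyY => ?_⟩
  set w := ‖m - y‖
  have hMy : ‖G.mapping y‖ ≤ V := norm_apply_le_of_lipschitzWith hL hyY
  have hm2 : 1 + ‖m‖ ^ 2 ≤ (2 + 2 * Y ^ 2) * (1 + w ^ 2) := one_add_norm_sq_le m hyY
  have hbias : 2 * (γ * s ^ 2) * (L * s * I₃ * w) ≤ L * I₃ * (γ * s ^ 2 * s) * (1 + w ^ 2) := by
    have : 0 ≤ L * I₃ * (γ * s ^ 2 * s) := by positivity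
    nlinarith [mul_nonneg this (sq_nonneg (1 - w))]
  have hvar : 3 * (γ * s ^ 2) ^ 2 * ((∫ z, ‖G.estimate s m (m + s • z)‖ ^ 2
      ∂(stdGaussian (Joint N d))) + ‖G.mapping y‖ ^ 2 + ε ^ 2 * w ^ 2) ≤
      C₃ * γ ^ 2 * (1 + w ^ 2) := by
    calc _ ≤ 3 * (γ * s ^ 2) ^ 2 * (C₂ / s ^ 2 * ((2 + 2 * Y ^ 2) * (1 + w ^ 2))
            + V ^ 2 * (1 + w ^ 2) + S ^ 2 * (1 + w ^ 2)) := by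
          gcongr
          · exact (hsecond s hs hsS m).trans (by gcongr)
          · calc ‖G.mapping y‖ ^ 2 ≤ V ^ 2 * 1 := by rw [mul_one]; gcongr
              _ ≤ V ^ 2 * (1 + w ^ 2) := by gcongr; linarith [sq_nonneg w]
          · linarith
      _ = 3 * (s ^ 2 * C₂ * (2 + 2 * Y ^ 2) + s ^ 4 * V ^ 2 + s ^ 4 * S ^ 2) * γ ^ 2
            * (1 + w ^ 2) := by field_simp
      _ ≤ C₃ * γ ^ 2 * (1 + w ^ 2) := by simp only [C₃]; gcongr
  refine (integral_norm_step_sub_step_sq_le (Game.memLp_estimate hG hgrowth hs m) (by positivity)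
    (Game.norm_integral_estimate_sub_mapping_le hG hgrowth hL hs m)
    (hmono m hm y hy)).trans ?_
  have hcross : 0 ≤ L * I₃ * γ ^ 2 * (1 + w ^ 2) ∧ 0 ≤ C₃ * (γ * s ^ 2 * s) * (1 + w ^ 2) := by
    constructor <;> positivity
  linarith

end GameStep

section ConditionalLaw

variable {Ω α β : Type*} {m mΩ : MeasurableSpace Ω} [MeasurableSpace α] [MeasurableSpace β]
  {P : Measure Ω} {X : Ω → α} {Y : Ω → β} {κ : Kernel α β}

theorem hasCondDistrib_of_condExp_indicator_ae_eq [IsFiniteMeasure P] [IsMarkovKernel κ]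
    (hm : m ≤ mΩ) (hX : Measurable[m] X) (hY : Measurable Y)
    (hκ : ∀ B, MeasurableSet B → P⟦Y ⁻¹' B | m⟧ =ᵐ[P] fun ω => (κ (X ω)).real B) :
    HasCondDistrib Y X κ P := by
  have hXΩ : Measurable X := hX.mono hm le_rfl
  refine ⟨(hXΩ.prodMk hY).aemeasurable, Measure.ext_prod fun {A B} hA hB => ?_⟩
  have hind : Integrable ((Y ⁻¹' B).indicator fun _ => (1 : ℝ)) P :=
    (integrable_const 1).indicator (hY hB)
  have hkernel : Integrable (fun ω => (κ (X ω)).real B) P :=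
    integrable_condExp.congr (hκ B hB)
  have hset : ∫ ω in X ⁻¹' A, (κ (X ω)).real B ∂P = P.real (X ⁻¹' A ∩ Y ⁻¹' B) := by
    rw [← setIntegral_congr_ae (hXΩ hA) ((hκ B hB).mono fun ω hω _ => hω),
      setIntegral_condExp hm hind (hX hA), setIntegral_indicator (hY hB)]
    simp
  calc P.map (fun ω => (X ω, Y ω)) (A ×ˢ B) = P (X ⁻¹' A ∩ Y ⁻¹' B) := by
        rw [Measure.map_apply (hXΩ.prodMk hY) (hA.prod hB), Set.mk_preimage_prod]
    _ = ENNReal.ofReal (∫ ω in X ⁻¹' A, (κ (X ω)).real B ∂P) := by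
        rw [hset, ofReal_measureReal]
    _ = ∫⁻ ω in X ⁻¹' A, κ (X ω) B ∂P := by
        rw [ofReal_integral_eq_lintegral_ofReal hkernel.integrableOn
          (ae_of_all _ fun ω => measureReal_nonneg)]
        simp only [measureReal_def, ENNReal.ofReal_toReal (measure_ne_top _ _)]
    _ = (P.map X ⊗ₘ κ) (A ×ˢ B) := by
        rw [Measure.compProd_apply_prod hA hB, setLIntegral_map hA (κ.measurable_coe hB) hXΩ]

theorem integrable_of_hasCondDistrib [IsFiniteMeasure P] [IsMarkovKernel κ] {E : Type*}
    [NormedAddCommGroup E] (h : HasCondDistrib Y X κ P) {f : α × β → E}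
    (hf : StronglyMeasurable f) (hκ : ∀ a, Integrable (fun y => f (a, y)) (κ a))
    (hint : Integrable (fun ω => ∫ y, ‖f (X ω, y)‖ ∂κ (X ω)) P) :
    Integrable (fun ω => f (X ω, Y ω)) P := by
  have hmap : Integrable f (P.map X ⊗ₘ κ) := by
    refine (Measure.integrable_compProd_iff hf.aestronglyMeasurable).2 ⟨ae_of_all _ hκ, ?_⟩
    rwa [integrable_map_measure hf.norm.integral_kernel_prod_right'.aestronglyMeasurable
      h.aemeasurable_fst]
  rwa [← h.map_eq, integrable_map_measure hf.aestronglyMeasurable h.aemeasurable] at hmap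

theorem condExp_ae_eq_integral_kernel [IsFiniteMeasure P] [IsMarkovKernel κ]
    {E : Type*} [NormedAddCommGroup E] [NormedSpace ℝ E] [CompleteSpace E] (hm : m ≤ mΩ)
    (hX : Measurable[m] X) (hY : Measurable Y)
    (hκ : ∀ B, MeasurableSet B → P⟦Y ⁻¹' B | m⟧ =ᵐ[P] fun ω => (κ (X ω)).real B)
    {f : α × β → E} (hf : StronglyMeasurable f) (hint : Integrable (fun ω => f (X ω, Y ω)) P) :
    P[fun ω => f (X ω, Y ω) | m] =ᵐ[P] fun ω => ∫ y, f (X ω, y) ∂κ (X ω) := by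
  have hXΩ : Measurable X := hX.mono hm le_rfl
  have hlaw : ∀ F, MeasurableSet[m] F → HasCondDistrib Y X κ (P.restrict F) := fun F hF =>
    hasCondDistrib_of_condExp_indicator_ae_eq hm hX hY fun B hB =>
      (condExp_restrict_ae_eq_restrict hm hF ((integrable_const 1).indicator (hY hB))).trans
        (ae_restrict_of_ae (hκ B hB))
  have hintF : ∀ F, MeasurableSet[m] F →
      Integrable f ((P.restrict F).map X ⊗ₘ κ) := fun F hF => by
    rw [← (hlaw F hF).map_eq, integrable_map_measure hf.aestronglyMeasurable (by fun_prop)]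
    exact hint.integrableOn
  refine (ae_eq_condExp_of_forall_setIntegral_eq hm hint
    (fun F hF _ => Integrable.comp_measurable
      (Integrable.integral_compProd (κ := Kernel.const Unit _) (hintF F hF)) hXΩ) (fun F hF _ => ?_)
    (hf.integral_kernel_prod_right'.comp_measurable hX).aestronglyMeasurable).symm
  calc ∫ ω in F, ∫ y, f (X ω, y) ∂κ (X ω) ∂P
      = ∫ p, f p ∂((P.restrict F).map X ⊗ₘ κ) := by
        rw [Measure.integral_compProd (hintF F hF), integral_map hXΩ.aemeasurable
          hf.integral_kernel_prod_right'.aestronglyMeasurable]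
    _ = ∫ ω in F, f (X ω, Y ω) ∂P := by
        rw [← (hlaw F hF).map_eq, integral_map (by fun_prop) hf.aestronglyMeasurable]

end ConditionalLaw

section PlayKernel

variable {N d : ℕ}

instance (m : Action d) (v : NNReal) : IsProbabilityMeasure
    ((Measure.pi fun k : Fin d => gaussianReal (m k) v).map (WithLp.toLp 2)) :=
  Measure.isProbabilityMeasure_map (by fun_prop)

instance (m : Joint N d) (s : ℝ) : IsProbabilityMeasure (playLaw m s) :=
  Measure.isProbabilityMeasure_map (by fun_prop)

theorem charFun_playLaw (m : Joint N d) (s : ℝ) (t : Joint N d) :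
    charFun (playLaw m s) t =
      Complex.exp ((inner ℝ m t : ℝ) * Complex.I - (s * ‖t‖) ^ 2 / 2) := by
  have hinner : inner ℝ m t = ∑ i, ∑ k, t i k * m i k := by simp [PiLp.inner_apply]
  have hnorm : ‖t‖ ^ 2 = ∑ i, ∑ k, t i k ^ 2 := by
    simp only [PiLp.norm_sq_eq_of_L2, Real.norm_eq_abs, sq_abs]
  have hvar : (((s ^ 2).toNNReal : ℝ) : ℂ) = (s : ℂ) ^ 2 := by
    rw [Real.coe_toNNReal _ (sq_nonneg s), Complex.ofReal_pow]
  simp only [playLaw, charFun_pi, charFun_gaussianReal, ← Complex.exp_sum, mul_pow,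
    ← Complex.ofReal_pow ‖t‖, hinner, hnorm, hvar, Finset.sum_sub_distrib, Complex.ofReal_sum,
    Complex.ofReal_mul, Complex.ofReal_pow, Finset.sum_mul, Finset.mul_sum, Finset.sum_div]

theorem playLaw_eq_map_stdGaussian (m : Joint N d) (s : ℝ) :
    playLaw m s = (stdGaussian (Joint N d)).map (fun z => m + s • z) := by
  have : IsProbabilityMeasure ((stdGaussian (Joint N d)).map (fun z => m + s • z)) :=
    Measure.isProbabilityMeasure_map (by fun_prop)
  have hcomp : (fun z : Joint N d => m + s • z) = (m + ·) ∘ (s • ·) := rfl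
  refine Measure.ext_of_charFun (funext fun t => ?_)
  rw [charFun_playLaw, hcomp, ← Measure.map_map (by fun_prop) (by fun_prop),
    charFun_map_const_add, charFun_map_smul, charFun_stdGaussian, ← Complex.exp_add, norm_smul,
    Real.norm_eq_abs]
  have habs : ((|s| : ℝ) : ℂ) ^ 2 = (s : ℂ) ^ 2 := by exact_mod_cast sq_abs s
  rw [Complex.ofReal_mul, mul_pow, mul_pow, habs]
  ring_nf

/-- The law of the joint action as a kernel in the mean, for a fixed standard deviation. -/
noncomputable def playKernel (N d : ℕ) (s : ℝ) : Kernel (Joint N d) (Joint N d) :=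
  (Kernel.id ×ₖ Kernel.const _ (stdGaussian (Joint N d))).map fun p => p.1 + s • p.2

instance (s : ℝ) : IsMarkovKernel (playKernel N d s) :=
  Kernel.IsMarkovKernel.map _ (by fun_prop)

theorem playKernel_apply (s : ℝ) (m : Joint N d) : playKernel N d s m = playLaw m s := by
  rw [playKernel, Kernel.map_apply _ (by fun_prop), Kernel.prod_apply, Kernel.id_apply,
    Kernel.const_apply, Measure.dirac_prod, Measure.map_map (by fun_prop) (by fun_prop),
    playLaw_eq_map_stdGaussian]
  rfl

theorem integral_playKernel {E : Type*} [NormedAddCommGroup E] [NormedSpace ℝ E] {f : Joint N d → E}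
    (hf : StronglyMeasurable f) (s : ℝ) (m : Joint N d) :
    ∫ x, f x ∂playKernel N d s m = ∫ z, f (m + s • z) ∂(stdGaussian (Joint N d)) := by
  rw [playKernel_apply, playLaw_eq_map_stdGaussian,
    integral_map (by fun_prop) hf.aestronglyMeasurable]

theorem integrable_playKernel_iff {E : Type*} [NormedAddCommGroup E] {f : Joint N d → E}
    (hf : StronglyMeasurable f) (s : ℝ) (m : Joint N d) :
    Integrable f (playKernel N d s m) ↔
      Integrable (fun z => f (m + s • z)) (stdGaussian (Joint N d)) := by
  rw [playKernel_apply, playLaw_eq_map_stdGaussian,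
    integrable_map_measure hf.aestronglyMeasurable (by fun_prop)]
  rfl

end PlayKernel

section AlmostSupermartingale

theorem summable_of_succ_le_sub_add {v w q : ℕ → ℝ} (hv : ∀ n, 0 ≤ v n) (hw : ∀ n, 0 ≤ w n)
    (hq : Summable q) (h : ∀ n, v (n + 1) ≤ v n - w n + q n) : Summable w := by
  obtain ⟨Q, hQ⟩ := hq.hasSum.tendsto_sum_nat.bddAbove_range
  have htelescope : ∀ n, v n + ∑ k ∈ Finset.range n, w k ≤ v 0 + ∑ k ∈ Finset.range n, q k := by
    intro n
    induction n with
    | zero => simp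
    | succ n ih =>
      rw [Finset.sum_range_succ, Finset.sum_range_succ]
      linarith [h n]
  exact summable_of_sum_range_le (c := v 0 + Q) hw fun n => by
    linarith [htelescope n, hv n, hQ ⟨n, rfl⟩]

theorem eq_zero_of_summable_mul_of_tendsto {α v : ℕ → ℝ} {l : ℝ} (hα : ¬ Summable α)
    (hαv : Summable fun n => α n * v n) (hv : Tendsto v atTop (𝓝 l)) : l = 0 := by
  by_contra hl
  have hv0 : ∀ᶠ n in atTop, v n ≠ 0 := hv.eventually_ne hl
  refine hα (summable_of_isBigO_nat hαv ?_)
  have hO : (fun n => α n * v n * (v n)⁻¹) =O[atTop] fun n => α n * v n * 1 :=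
    (Asymptotics.isBigO_refl _ _).mul ((hv.inv₀ hl).isBigO_one ℝ)
  simp only [mul_one] at hO
  refine hO.congr' ?_ EventuallyEq.rfl
  filter_upwards [hv0] with n hn
  rw [mul_assoc, mul_inv_cancel₀ hn, mul_one]

variable {Ω : Type*} [mΩ : MeasurableSpace Ω] {P : Measure Ω} {ℱ : Filtration ℕ mΩ}
  {V W : ℕ → Ω → ℝ} {α p q : ℕ → ℝ}

theorem ae_summable_of_summable_integral {f : ℕ → Ω → ℝ} (hint : ∀ n, Integrable (f n) P)
    (hf : ∀ n ω, 0 ≤ f n ω) (hsum : Summable fun n => ∫ ω, f n ω ∂P) :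
    ∀ᵐ ω ∂P, Summable fun n => f n ω := by
  have hmeas := fun n => (hint n).aemeasurable.ennreal_ofReal
  have hfin : ∫⁻ ω, ∑' n, ENNReal.ofReal (f n ω) ∂P ≠ ⊤ := by
    rw [lintegral_tsum hmeas]
    simp_rw [← ofReal_integral_eq_lintegral_ofReal (hint _) (ae_of_all _ (hf _))]
    exact hsum.tsum_ofReal_ne_top
  filter_upwards [ae_lt_top' (AEMeasurable.tsum hmeas) hfin] with ω hω
  exact (ENNReal.summable_toReal hω.ne).congr fun n => ENNReal.toReal_ofReal (hf n ω)

theorem ae_exists_tendsto_of_supermartingale_of_forall_le [IsFiniteMeasure P] {U : ℕ → Ω → ℝ}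
    (hU : Supermartingale U ℱ P) {c : ℝ} (hc : ∀ n ω, c ≤ U n ω) :
    ∀ᵐ ω ∂P, ∃ l, Tendsto (fun n => U n ω) atTop (𝓝 l) := by
  have hbound : ∀ n, eLpNorm (U n) 1 P
      ≤ (((∫ ω, U 0 ω ∂P) + P.real Set.univ * (2 * |c|)).toNNReal : ENNReal) := by
    intro n
    rw [eLpNorm_one_eq_lintegral_enorm,
      ← ofReal_integral_norm_eq_lintegral_enorm (hU.integrable n)]
    refine ENNReal.ofReal_le_ofReal ?_
    calc ∫ ω, ‖U n ω‖ ∂P ≤ ∫ ω, (U n ω + 2 * |c|) ∂P := by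
          refine integral_mono (hU.integrable n).norm
            ((hU.integrable n).add (integrable_const _)) fun ω => abs_le.2 ⟨?_, ?_⟩
          all_goals linarith [hc n ω, neg_abs_le c, abs_nonneg c]
      _ = (∫ ω, U n ω ∂P) + P.real Set.univ * (2 * |c|) := by
          rw [integral_add (hU.integrable n) (integrable_const _), integral_const, smul_eq_mul]
      _ ≤ (∫ ω, U 0 ω ∂P) + P.real Set.univ * (2 * |c|) := by
          refine add_le_add ?_ le_rfl
          simpa using hU.setIntegral_le (Nat.zero_le n) MeasurableSet.univ
  have hneg := hU.neg.exists_ae_tendsto_of_bdd fun n => by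
    rw [Pi.neg_apply, eLpNorm_neg]
    exact hbound n
  filter_upwards [hneg] with ω ⟨l, hl⟩
  exact ⟨-l, by simpa using hl.neg⟩

theorem ae_summable_of_condExp_succ_le [IsFiniteMeasure P] (hVint : ∀ n, Integrable (V n) P)
    (hV : ∀ n ω, 0 ≤ V n ω) (hWint : ∀ n, Integrable (W n) P) (hW : ∀ n ω, 0 ≤ W n ω)
    (hq : Summable q)
    (hstep : ∀ n, ∀ᵐ ω ∂P, (P[V (n + 1) | ℱ n]) ω ≤ V n ω - W n ω + q n) :
    ∀ᵐ ω ∂P, Summable fun n => W n ω := by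
  refine ae_summable_of_summable_integral hWint hW ?_
  refine summable_of_succ_le_sub_add (v := fun n => ∫ ω, V n ω ∂P)
    (fun n => integral_nonneg (hV n)) (fun n => integral_nonneg (hW n))
    (hq.mul_left (P.real Set.univ)) fun n => ?_
  calc ∫ ω, V (n + 1) ω ∂P = ∫ ω, (P[V (n + 1) | ℱ n]) ω ∂P := (integral_condExp (ℱ.le n)).symm
    _ ≤ ∫ ω, (V n ω - W n ω + q n) ∂P :=
        integral_mono_ae integrable_condExp
          (((hVint n).sub (hWint n)).add (integrable_const _)) (hstep n)
    _ = (∫ ω, V n ω ∂P) - (∫ ω, W n ω ∂P) + P.real Set.univ * q n := by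
        rw [integral_add (f := fun ω => V n ω - W n ω) ((hVint n).sub (hWint n))
          (integrable_const _), integral_sub (hVint n) (hWint n), integral_const, smul_eq_mul]

theorem ae_exists_tendsto_of_condExp_succ_le [IsFiniteMeasure P] (hadp : StronglyAdapted ℱ V)
    (hVint : ∀ n, Integrable (V n) P) (hV : ∀ n ω, 0 ≤ V n ω) (hq : Summable q)
    (hstep : ∀ n, ∀ᵐ ω ∂P, (P[V (n + 1) | ℱ n]) ω ≤ V n ω + q n) :
    ∀ᵐ ω ∂P, ∃ l, Tendsto (fun n => V n ω) atTop (𝓝 l) := by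
  set Q : ℕ → ℝ := fun n => ∑ k ∈ Finset.range n, q k
  have hQ : Tendsto Q atTop (𝓝 (∑' k, q k)) := hq.hasSum.tendsto_sum_nat
  obtain ⟨B, hB⟩ := hQ.bddAbove_range
  have hsuper : Supermartingale (fun n ω => V n ω - Q n) ℱ P := by
    refine supermartingale_nat (fun n => (hadp n).sub stronglyMeasurable_const)
      (fun n => (hVint n).sub (integrable_const _)) fun n => ?_
    have hsub := condExp_sub (hVint (n + 1)) (integrable_const (Q (n + 1))) (ℱ n)
    rw [condExp_const (ℱ.le n)] at hsub
    filter_upwards [hsub, hstep n] with ω hω hle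
    have hsucc : Q (n + 1) = Q n + q n := Finset.sum_range_succ q n
    refine hω.trans_le ?_
    rw [Pi.sub_apply, hsucc]
    linarith
  filter_upwards [ae_exists_tendsto_of_supermartingale_of_forall_le hsuper (c := -B)
    fun n ω => by linarith [hV n ω, hB ⟨n, rfl⟩]] with ω ⟨l, hl⟩
  exact ⟨l + ∑' k, q k, by simpa using hl.add hQ⟩

/-- The filtration `ℱ` started at time `k`. -/
def shiftFiltration (ℱ : Filtration ℕ mΩ) (k : ℕ) : Filtration ℕ mΩ where
  seq n := ℱ (n + k)
  mono' _ _ hij := ℱ.mono (Nat.add_le_add_right hij k)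
  le' n := ℱ.le (n + k)

theorem exists_discount (hp : Summable p) :
    ∃ (c : ℕ → ℝ) (l : ℝ), (∀ n, 0 < c n) ∧ (∀ n, c (n + 1) * (1 + p n) ≤ c n) ∧
      0 < l ∧ Tendsto c atTop (𝓝 l) := by
  refine ⟨fun n => Real.exp (-∑ k ∈ Finset.range n, p k), Real.exp (-∑' k, p k),
    fun n => Real.exp_pos _, fun n => ?_, Real.exp_pos _,
    (Real.continuous_exp.tendsto _).comp hp.hasSum.tendsto_sum_nat.neg⟩
  calc Real.exp (-∑ k ∈ Finset.range (n + 1), p k) * (1 + p n)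
      ≤ Real.exp (-∑ k ∈ Finset.range (n + 1), p k) * Real.exp (p n) := by
        gcongr
        linarith [Real.add_one_le_exp (p n)]
    _ = Real.exp (-∑ k ∈ Finset.range n, p k) := by
        rw [← Real.exp_add, Finset.sum_range_succ]
        ring_nf

/-- The Robbins–Siegmund theorem with deterministic coefficients. -/
theorem ae_exists_tendsto_and_summable_of_condExp_succ_le [IsFiniteMeasure P]
    (hadp : StronglyAdapted ℱ V) (hVint : ∀ n, Integrable (V n) P) (hV : ∀ n ω, 0 ≤ V n ω)
    (hWint : ∀ n, Integrable (W n) P) (hW : ∀ n ω, 0 ≤ W n ω) (hp : Summable p) (hq : Summable q)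
    (hstep : ∀ n, ∀ᵐ ω ∂P, (P[V (n + 1) | ℱ n]) ω ≤ (1 + p n) * V n ω - W n ω + q n) :
    ∀ᵐ ω ∂P, (∃ l, Tendsto (fun n => V n ω) atTop (𝓝 l)) ∧ Summable fun n => W n ω := by
  obtain ⟨c, l, hc, hcp, hl, hcl⟩ := exists_discount hp
  have hcl' : Tendsto (fun n => c (n + 1)) atTop (𝓝 l) := (tendsto_add_atTop_iff_nat 1).2 hcl
  have hcq : Summable fun n => c (n + 1) * q n := by
    refine summable_of_isBigO_nat hq ?_
    simpa using (hcl'.isBigO_one ℝ).mul (Asymptotics.isBigO_refl q atTop)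
  have hdisc : ∀ n, ∀ᵐ ω ∂P, (P[fun ω => c (n + 1) * V (n + 1) ω | ℱ n]) ω
      ≤ c n * V n ω - c (n + 1) * W n ω + c (n + 1) * q n := by
    intro n
    filter_upwards [condExp_smul (c (n + 1)) (V (n + 1)) (ℱ n), hstep n] with ω hω hle
    refine hω.trans_le ((mul_le_mul_of_nonneg_left hle (hc _).le).trans ?_)
    linarith [mul_le_mul_of_nonneg_right (hcp n) (hV n ω)]
  have hcV := fun n ω => mul_nonneg (hc n).le (hV n ω)
  have hcW := fun n ω => mul_nonneg (hc (n + 1)).le (hW n ω)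
  filter_upwards [ae_exists_tendsto_of_condExp_succ_le (fun n => (hadp n).const_mul (c n))
      (fun n => (hVint n).const_mul _) hcV hcq
      fun n => (hdisc n).mono fun ω hω => hω.trans (by linarith [hcW n ω]),
    ae_summable_of_condExp_succ_le (fun n => (hVint n).const_mul _) hcV
      (fun n => (hWint n).const_mul _) hcW hcq hdisc] with ω ⟨v, hv⟩ hsum
  refine ⟨⟨v / l, (hv.div hcl hl.ne').congr fun n => mul_div_cancel_left₀ _ (hc n).ne'⟩, ?_⟩
  have hinv := ((hcl'.inv₀ hl.ne').isBigO_one ℝ).mul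
    (Asymptotics.isBigO_refl (fun n => c (n + 1) * W n ω) atTop)
  refine summable_of_isBigO_nat hsum ?_
  simpa only [inv_mul_cancel_left₀ (hc _).ne', one_mul] using hinv

theorem ae_tendsto_zero_of_condExp_succ_le [IsFiniteMeasure P] (hadp : StronglyAdapted ℱ V)
    (hVint : ∀ n, Integrable (V n) P) (hV : ∀ n ω, 0 ≤ V n ω) (hα : ∀ n, 0 ≤ α n)
    (hαs : ¬ Summable α) (hp : Summable p) (hq : Summable q)
    (hstep : ∀ᶠ n in atTop, ∀ᵐ ω ∂P,
      (P[V (n + 1) | ℱ n]) ω ≤ (1 - α n + p n) * V n ω + q n) :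
    ∀ᵐ ω ∂P, Tendsto (fun n => V n ω) atTop (𝓝 0) := by
  obtain ⟨T, hT⟩ := eventually_atTop.1 hstep
  have hshift : ∀ n, ∀ᵐ ω ∂P, (P[V (n + 1 + T) | shiftFiltration ℱ T n]) ω
      ≤ (1 + p (n + T)) * V (n + T) ω - α (n + T) * V (n + T) ω + q (n + T) := fun n => by
    filter_upwards [hT (n + T) (Nat.le_add_left T n)] with ω hω
    rw [Nat.add_right_comm]
    exact hω.trans_eq (by ring)
  filter_upwards [ae_exists_tendsto_and_summable_of_condExp_succ_le
    (V := fun n => V (n + T)) (W := fun n ω => α (n + T) * V (n + T) ω)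
    (fun n => hadp (n + T)) (fun n => hVint _) (fun n => hV _) (fun n => (hVint _).const_mul _)
    (fun n ω => mul_nonneg (hα _) (hV _ ω)) ((summable_nat_add_iff T).2 hp)
    ((summable_nat_add_iff T).2 hq) hshift] with ω ⟨⟨l, hl⟩, hsum⟩
  have hl0 : l = 0 := eq_zero_of_summable_mul_of_tendsto
    (fun h => hαs ((summable_nat_add_iff T).1 h)) hsum hl
  exact (tendsto_add_atTop_iff_nat (f := fun n => V n ω) T).1 (hl0 ▸ hl)

end AlmostSupermartingale

section Run

variable {N d : ℕ} {Ω : Type*} [mΩ : MeasurableSpace Ω] {P : Measure Ω}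
  {ℱ : Filtration ℕ mΩ} {G : Game N d} {γ σ ε : ℕ → ℝ} {m₀ : Joint N d} {μ x : ℕ → Ω → Joint N d}

theorem IsRun.measurable_mean (h : IsRun P ℱ G γ σ ε m₀ μ x) (t : ℕ) : Measurable (μ t) :=
  (h.mean_meas t).mono (ℱ.le t) le_rfl

theorem IsRun.measurable_play (h : IsRun P ℱ G γ σ ε m₀ μ x) (t : ℕ) : Measurable (x t) :=
  (h.play_meas t).mono (ℱ.le (t + 1)) le_rfl

theorem IsRun.condExp_indicator_play (h : IsRun P ℱ G γ σ ε m₀ μ x) (t : ℕ) (B : Set (Joint N d))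
    (hB : MeasurableSet B) :
    P⟦x t ⁻¹' B | ℱ t⟧ =ᵐ[P] fun ω => (playKernel N d (σ t) (μ t ω)).real B := by
  simpa only [playKernel_apply] using h.play_law t B hB

theorem IsRun.hasCondDistrib_play [IsFiniteMeasure P] (h : IsRun P ℱ G γ σ ε m₀ μ x) (t : ℕ) :
    HasCondDistrib (x t) (μ t) (playKernel N d (σ t)) P :=
  hasCondDistrib_of_condExp_indicator_ae_eq (ℱ.le t) (h.mean_meas t) (h.measurable_play t)
    (h.condExp_indicator_play t)

theorem IsRun.next_mem (h : IsRun P ℱ G γ σ ε m₀ μ x) (t : ℕ) (ω : Ω) :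
    μ (t + 1) ω ∈ G.jointSet := fun i => (h.update t ω i).1

theorem IsRun.isVISol_next (h : IsRun P ℱ G γ σ ε m₀ μ x) (hG : G.IsConvex) (t : ℕ) (ω : Ω) :
    IsVISol G.jointSet (· - G.step (γ t) (σ t) (ε t) (μ t ω) (x t ω)) (μ (t + 1) ω) := by
  refine isVISol_sub_of_forall_norm_sub_le hG.convex_jointSet (h.next_mem t ω) fun q hq => ?_
  rw [PiLp.norm_eq_of_L2, PiLp.norm_eq_of_L2]
  gcongr with i
  exact (h.update t ω i).2 (q i) (hq i)

theorem IsRun.norm_next_sub_le (h : IsRun P ℱ G γ σ ε m₀ μ x) (hG : G.IsConvex) {t : ℕ}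
    (hβ : 0 < γ t * σ t ^ 2) {y : Joint N d}
    (hy : IsVISol G.jointSet (regularize G.mapping (ε t)) y) (ω : Ω) :
    ‖μ (t + 1) ω - y‖ ≤ ‖G.step (γ t) (σ t) (ε t) (μ t ω) (x t ω)
      - (y - (γ t * σ t ^ 2) • regularize G.mapping (ε t) y)‖ :=
  (h.isVISol_next hG t ω).norm_sub_le_of_sub ((isVISol_sub_sub_smul_iff hβ).2 hy)

theorem Game.IsConvex.continuous_estimate (hG : G.IsConvex) (s : ℝ) :
    Continuous fun p : Joint N d × Joint N d => G.estimate s p.1 p.2 := by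
  have := fun i => (hG.contDiff_cost i).continuous
  unfold Game.estimate
  fun_prop

theorem Game.IsConvex.continuous_step (hG : G.IsConvex) (g s e : ℝ) :
    Continuous fun p : Joint N d × Joint N d => G.step g s e p.1 p.2 := by
  have := hG.continuous_estimate s
  unfold Game.step
  fun_prop

theorem IsRun.memLp_estimate [IsFiniteMeasure P] (h : IsRun P ℱ G γ σ ε m₀ μ x) (hG : G.IsConvex)
    (hgrowth : G.LinearGrowth) {t : ℕ} (hσ : 0 < σ t) (hμ : MemLp (μ t) 2 P) :
    MemLp (fun ω => G.estimate (σ t) (μ t ω) (x t ω)) 2 P := by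
  have hcont := hG.continuous_estimate (σ t)
  have hf : StronglyMeasurable fun p : Joint N d × Joint N d =>
    ‖G.estimate (σ t) p.1 p.2‖ ^ 2 := (hcont.norm.pow 2).stronglyMeasurable
  have hfm : ∀ m, StronglyMeasurable fun y => ‖G.estimate (σ t) m y‖ ^ 2 := fun m =>
    ((hcont.comp (Continuous.prodMk_right m)).norm.pow 2).stronglyMeasurable
  obtain ⟨C, -, hC⟩ := hgrowth.exists_integral_norm_sq_estimate_le hG (σ t)
  have hdom : Integrable (fun ω => C / σ t ^ 2 * (1 + ‖μ t ω‖ ^ 2)) P :=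
    ((integrable_const 1).add (hμ.integrable_norm_pow two_ne_zero)).const_mul _
  have hmeas : Measurable fun ω => G.estimate (σ t) (μ t ω) (x t ω) :=
    hcont.measurable.comp ((h.measurable_mean t).prodMk (h.measurable_play t))
  rw [memLp_two_iff_integrable_sq_norm hmeas.aestronglyMeasurable]
  refine integrable_of_hasCondDistrib (h.hasCondDistrib_play t) hf (fun m => ?_) ?_
  · rw [integrable_playKernel_iff (hfm m)]
    exact (Game.memLp_estimate hG hgrowth hσ m).integrable_norm_pow two_ne_zero
  · refine hdom.mono' (hf.norm.integral_kernel_prod_right'.comp_measurable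
      (h.measurable_mean t)).aestronglyMeasurable (ae_of_all _ fun ω => ?_)
    simp only [norm_pow, norm_norm]
    rw [integral_playKernel (hfm _), Real.norm_of_nonneg (integral_nonneg fun _ => by positivity)]
    exact hC _ hσ le_rfl _

theorem IsRun.memLp_step [IsFiniteMeasure P] (h : IsRun P ℱ G γ σ ε m₀ μ x) (hG : G.IsConvex)
    (hgrowth : G.LinearGrowth) {t : ℕ} (hσ : 0 < σ t) (hμ : MemLp (μ t) 2 P) :
    MemLp (fun ω => G.step (γ t) (σ t) (ε t) (μ t ω) (x t ω)) 2 P := by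
  have hsum := (h.memLp_estimate hG hgrowth hσ hμ).add (hμ.const_smul (ε t))
  exact hμ.sub (hsum.const_smul (γ t * σ t ^ 2))

theorem IsRun.memLp_mean [IsFiniteMeasure P] (h : IsRun P ℱ G γ σ ε m₀ μ x) (hG : G.IsConvex)
    (hgrowth : G.LinearGrowth) (hσ : ∀ t, 0 < σ t) (t : ℕ) : MemLp (μ t) 2 P := by
  induction t with
  | zero =>
    rw [funext h.init]
    exact memLp_const m₀
  | succ t ih =>
    rcases isEmpty_or_nonempty Ω with hΩ | ⟨⟨ω₀⟩⟩
    · rw [Measure.eq_zero_of_isEmpty P]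
      exact memLp_measure_zero
    have hbase : IsVISol G.jointSet (· - μ (t + 1) ω₀) (μ (t + 1) ω₀) :=
      ⟨h.next_mem t ω₀, fun z _ => by simp⟩
    have hdist : MemLp (fun ω => μ (t + 1) ω - μ (t + 1) ω₀) 2 P :=
      ((h.memLp_step hG hgrowth (hσ t) ih).sub (memLp_const (μ (t + 1) ω₀))).of_le
        ((h.measurable_mean _).sub_const _).aestronglyMeasurable
        (ae_of_all _ fun ω => (h.isVISol_next hG t ω).norm_sub_le_of_sub hbase)
    convert hdist.add (memLp_const (μ (t + 1) ω₀)) using 1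
    exact funext fun ω => (sub_add_cancel _ _).symm

theorem IsRun.integrable_norm_mean_sub_sq [IsFiniteMeasure P] (h : IsRun P ℱ G γ σ ε m₀ μ x)
    (hG : G.IsConvex) (hgrowth : G.LinearGrowth) (hσ : ∀ t, 0 < σ t) (t : ℕ) (y : Joint N d) :
    Integrable (fun ω => ‖μ t ω - y‖ ^ 2) P :=
  ((h.memLp_mean hG hgrowth hσ t).sub (memLp_const y)).integrable_norm_pow two_ne_zero

theorem IsRun.condExp_norm_next_sub_sq_le [IsFiniteMeasure P] (h : IsRun P ℱ G γ σ ε m₀ μ x)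
    (hG : G.IsConvex) (hgrowth : G.LinearGrowth) (hσ : ∀ t, 0 < σ t) {t : ℕ} (hγ : 0 < γ t)
    {y : Joint N d} (hy : IsVISol G.jointSet (regularize G.mapping (ε t)) y) :
    ∀ᵐ ω ∂P, (P[fun ω => ‖μ (t + 1) ω - y‖ ^ 2 | ℱ t]) ω ≤
      ∫ z, ‖G.step (γ t) (σ t) (ε t) (μ t ω) (μ t ω + σ t • z)
        - (y - (γ t * σ t ^ 2) • regularize G.mapping (ε t) y)‖ ^ 2
        ∂(stdGaussian (Joint N d)) := by
  set v := y - (γ t * σ t ^ 2) • regularize G.mapping (ε t) y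
  have hf : Continuous fun p : Joint N d × Joint N d =>
      ‖G.step (γ t) (σ t) (ε t) p.1 p.2 - v‖ ^ 2 := by
    have := hG.continuous_step (γ t) (σ t) (ε t)
    fun_prop
  have hint : Integrable (fun ω => ‖G.step (γ t) (σ t) (ε t) (μ t ω) (x t ω) - v‖ ^ 2) P :=
    ((h.memLp_step hG hgrowth (hσ t) (h.memLp_mean hG hgrowth hσ t)).sub
      (memLp_const v)).integrable_norm_pow two_ne_zero
  have hσt := hσ t
  have hmono := condExp_mono (m := ℱ t)
    (h.integrable_norm_mean_sub_sq hG hgrowth hσ (t + 1) y) hint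
    (ae_of_all _ fun ω => pow_le_pow_left₀ (norm_nonneg _)
      (h.norm_next_sub_le hG (by positivity) hy ω) 2)
  have hfm (m : Joint N d) :
      StronglyMeasurable fun x => ‖G.step (γ t) (σ t) (ε t) m x - v‖ ^ 2 :=
    (hf.comp (Continuous.prodMk_right m)).stronglyMeasurable
  filter_upwards [hmono, condExp_ae_eq_integral_kernel (ℱ.le t) (h.mean_meas t)
    (h.measurable_play t) (h.condExp_indicator_play t) hf.stronglyMeasurable hint] with ω hle heq
  rw [heq, integral_playKernel (hfm _)] at hle
  exact hle

end Run

/-- The conditions on the step sizes `γ`, the standard deviations `σ` and the regularization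
parameters `ε` under which the algorithm converges, whatever their form. -/
structure AdmissibleSteps (γ σ ε : ℕ → ℝ) : Prop where
  gamma_pos : ∀ t, 0 < γ t
  sigma_pos : ∀ t, 0 < σ t
  eps_pos : ∀ t, 0 < ε t
  sigma_lim : Tendsto σ atTop (𝓝 0)
  eps_lim : Tendsto ε atTop (𝓝 0)
  drift_sum : Summable fun t =>
    (1 + 1 / (γ (t + 1) * σ (t + 1) ^ 2 * ε (t + 1))) * (|ε t - ε (t + 1)| ^ 2 / ε (t + 1) ^ 2)
  gamma_sq_sum : Summable fun t => γ t ^ 2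
  beta_sigma_sum : Summable fun t => γ t * σ t ^ 2 * σ t
  beta_eps_sum : ¬ Summable fun t => γ t * σ t ^ 2 * ε t

section Steps

variable {γ σ ε : ℕ → ℝ}

theorem pos_of_eq_one_div_rpow {f : ℕ → ℝ} {a : ℝ} (h0 : 0 < f 0)
    (h : ∀ t : ℕ, 1 ≤ t → f t = 1 / (t : ℝ) ^ a) (t : ℕ) : 0 < f t := by
  rcases t with _ | t
  · exact h0
  · rw [h _ (by omega)]
    positivity

theorem StepSizes.admissibleSteps {a b c : ℝ} (h : StepSizes a b c γ σ ε) :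
    AdmissibleSteps γ σ ε where
  gamma_pos := pos_of_eq_one_div_rpow h.gamma_zero h.gamma_eq
  sigma_pos := pos_of_eq_one_div_rpow h.sigma_zero h.sigma_eq
  eps_pos := pos_of_eq_one_div_rpow h.eps_zero h.eps_eq
  sigma_lim := h.sigma_lim
  eps_lim := h.eps_lim
  drift_sum := h.drift_sum
  gamma_sq_sum := h.gamma_sq_sum
  beta_sigma_sum := h.beta_sigma_sum
  beta_eps_sum := h.beta_eps_sum

theorem AdmissibleSteps.beta_eps_pos (h : AdmissibleSteps γ σ ε) (t : ℕ) :
    0 < γ t * σ t ^ 2 * ε t :=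
  mul_pos (mul_pos (h.gamma_pos t) (pow_pos (h.sigma_pos t) 2)) (h.eps_pos t)

theorem AdmissibleSteps.tendsto_beta_eps (h : AdmissibleSteps γ σ ε) :
    Tendsto (fun t => γ t * σ t ^ 2 * ε t) atTop (𝓝 0) := by
  have hγ : Tendsto γ atTop (𝓝 0) := by
    have hsqrt := h.gamma_sq_sum.tendsto_atTop_zero.sqrt
    rw [Real.sqrt_zero] at hsqrt
    exact hsqrt.congr fun t => Real.sqrt_sq (h.gamma_pos t).le
  simpa using (hγ.mul (h.sigma_lim.pow 2)).mul h.eps_lim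

theorem AdmissibleSteps.tendsto_eps_nhdsGT (h : AdmissibleSteps γ σ ε) :
    Tendsto ε atTop (𝓝[>] 0) :=
  tendsto_nhdsWithin_iff.2 ⟨h.eps_lim, Eventually.of_forall h.eps_pos⟩

theorem AdmissibleSteps.exists_forall_le (h : AdmissibleSteps γ σ ε) :
    ∃ S, ∀ t, σ t ≤ S ∧ ε t ≤ S := by
  obtain ⟨S, hS⟩ := h.sigma_lim.bddAbove_range
  obtain ⟨S', hS'⟩ := h.eps_lim.bddAbove_range
  exact ⟨max S S', fun t => ⟨le_max_of_le_left (hS ⟨t, rfl⟩), le_max_of_le_right (hS' ⟨t, rfl⟩)⟩⟩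

end Steps

section Recursion

theorem norm_sub_sq_le_mul_add {E : Type*} [SeminormedAddCommGroup E] (m y y' : E) {r : ℝ}
    (hr : 0 < r) :
    ‖m - y‖ ^ 2 ≤ (1 + r) * ‖m - y'‖ ^ 2 + (1 + 1 / r) * ‖y' - y‖ ^ 2 := by
  have hsq : 0 ≤ (r * ‖m - y'‖ - ‖y' - y‖) ^ 2 / r := by positivity
  calc ‖m - y‖ ^ 2 ≤ (‖m - y'‖ + ‖y' - y‖) ^ 2 := by
        gcongr
        exact norm_sub_le_norm_sub_add_norm_sub _ _ _
    _ ≤ (‖m - y'‖ + ‖y' - y‖) ^ 2 + (r * ‖m - y'‖ - ‖y' - y‖) ^ 2 / r := by linarith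
    _ = (1 + r) * ‖m - y'‖ ^ 2 + (1 + 1 / r) * ‖y' - y‖ ^ 2 := by field_simp; ring

theorem contraction_add_error_le {w V α κ K δ : ℝ} (hα : 0 < α) (hα' : α ≤ 1 / 2) (hκ : 0 ≤ κ)
    (hκK : κ ≤ K) (hV : 0 ≤ V) (hδ : 0 ≤ δ) (hw : w ≤ (1 + α) * V + (1 + 1 / α) * δ) :
    (1 - 2 * α) * w + κ * (1 + w) ≤
      (1 - α + 2 * κ) * V + ((1 + K) * ((1 + 1 / α) * δ) + κ) := by
  have h0 : 0 ≤ 1 - 2 * α + κ := by linarith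
  have hfactor : (1 - 2 * α + κ) * (1 + α) ≤ 1 - α + 2 * κ := by nlinarith
  calc (1 - 2 * α) * w + κ * (1 + w) = (1 - 2 * α + κ) * w + κ := by ring
    _ ≤ (1 - 2 * α + κ) * ((1 + α) * V + (1 + 1 / α) * δ) + κ := by gcongr
    _ = (1 - 2 * α + κ) * (1 + α) * V + ((1 - 2 * α + κ) * ((1 + 1 / α) * δ) + κ) := by ring
    _ ≤ (1 - α + 2 * κ) * V + ((1 + K) * ((1 + 1 / α) * δ) + κ) := by gcongr; linarith

theorem norm_sub_sq_le_of_isVISol_regularize {E : Type*} [NormedAddCommGroup E]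
    [InnerProductSpace ℝ E] {T : E → E} {K : Set E} (hT : IsMonotoneMapOn T K) {u v m : E}
    {ε δ r Y : ℝ} (hε : 0 < ε) (hu : IsVISol K (regularize T ε) u)
    (hv : IsVISol K (regularize T δ) v) (hvY : ‖v‖ ≤ Y) (hr : 0 < r) :
    ‖m - u‖ ^ 2 ≤ (1 + r) * ‖m - v‖ ^ 2 + (1 + 1 / r) * (Y ^ 2 * (|δ - ε| ^ 2 / ε ^ 2)) := by
  have hdrift : ‖v - u‖ ≤ |ε - δ| / ε * Y := (hT.norm_sub_le hε hu hv).trans (by gcongr)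
  calc ‖m - u‖ ^ 2 ≤ (1 + r) * ‖m - v‖ ^ 2 + (1 + 1 / r) * ‖v - u‖ ^ 2 :=
        norm_sub_sq_le_mul_add m u v hr
    _ ≤ (1 + r) * ‖m - v‖ ^ 2 + (1 + 1 / r) * (|ε - δ| / ε * Y) ^ 2 := by gcongr
    _ = _ := by rw [abs_sub_comm ε δ, mul_pow, div_pow, mul_comm (Y ^ 2)]

end Recursion

theorem tendstoInMeasure_add {ι Ω E : Type*} [MeasurableSpace Ω] {P : Measure Ω}
    [SeminormedAddCommGroup E] {l : Filter ι} {f f' : ι → Ω → E} {g g' : Ω → E}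
    (hf : TendstoInMeasure P f l g) (hf' : TendstoInMeasure P f' l g') :
    TendstoInMeasure P (fun i ω => f i ω + f' i ω) l fun ω => g ω + g' ω := by
  rw [tendstoInMeasure_iff_norm] at hf hf' ⊢
  intro r hr
  have hsum := (hf (r / 2) (half_pos hr)).add (hf' (r / 2) (half_pos hr))
  rw [add_zero] at hsum
  refine tendsto_of_tendsto_of_tendsto_of_le_of_le tendsto_const_nhds hsum (fun _ => zero_le)
    fun i => (measure_mono fun ω hω => ?_).trans (measure_union_le _ _)
  rw [Set.mem_union]
  by_contra! hlt
  simp only [Set.mem_ofPred_eq, not_le] at hω hlt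
  refine hω.not_gt ?_
  calc ‖f i ω + f' i ω - (g ω + g' ω)‖ ≤ ‖f i ω - g ω‖ + ‖f' i ω - g' ω‖ := by
        rw [add_sub_add_comm]
        exact norm_add_le _ _
    _ < r := by linarith [hlt.1, hlt.2]

section Convergence

variable {N d : ℕ} {Ω : Type*} [mΩ : MeasurableSpace Ω] {P : Measure Ω}
  {ℱ : Filtration ℕ mΩ} {G : Game N d} {γ σ ε : ℕ → ℝ} {m₀ : Joint N d} {μ x : ℕ → Ω → Joint N d}

theorem IsRun.exists_summable_condExp_norm_sub_sq_le [IsFiniteMeasure P]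
    (h : IsRun P ℱ G γ σ ε m₀ μ x) (hG : G.IsConvex)
    (hmono : IsMonotoneOver G.mapping G.jointSet) (hlip : G.LipschitzMapping)
    (hgrowth : G.LinearGrowth) (hstep : AdmissibleSteps γ σ ε) (Y : ℝ) :
    ∃ κ : ℕ → ℝ, (∀ t, 0 ≤ κ t) ∧ Summable κ ∧
      ∀ t y, IsVISol G.jointSet (regularize G.mapping (ε (t + 1))) y → ‖y‖ ≤ Y →
        ∀ᵐ ω ∂P, (P[fun ω => ‖μ (t + 2) ω - y‖ ^ 2 | ℱ (t + 1)]) ω ≤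
          (1 - 2 * (γ (t + 1) * σ (t + 1) ^ 2 * ε (t + 1))) * ‖μ (t + 1) ω - y‖ ^ 2
            + κ (t + 1) * (1 + ‖μ (t + 1) ω - y‖ ^ 2) := by
  obtain ⟨S, hS⟩ := hstep.exists_forall_le
  obtain ⟨C, hC, hbound⟩ := exists_integral_step_sq_le hG hmono hlip hgrowth S Y
  refine ⟨fun t => C * (γ t * σ t ^ 2 * σ t + γ t ^ 2), fun t => ?_,
    (hstep.beta_sigma_sum.add hstep.gamma_sq_sum).mul_left C, fun t y hy hyY => ?_⟩
  · have := hstep.gamma_pos t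
    have := hstep.sigma_pos t
    positivity
  filter_upwards [h.condExp_norm_next_sub_sq_le hG hgrowth hstep.sigma_pos
    (hstep.gamma_pos (t + 1)) hy] with ω hω
  rw [← mul_assoc 2]
  exact hω.trans (hbound _ _ _ (hstep.gamma_pos _).le (hstep.sigma_pos _) (hS _).1
    (hstep.eps_pos _).le (hS _).2 _ (h.next_mem t ω) y hy.1 hyY)

/-- The lag of one step between the means and the regularized solutions comes from the order of the
updates: `μ (t + 1)` is computed with `ε t`. -/
theorem IsRun.ae_tendsto_norm_sub_regularized [IsFiniteMeasure P]
    (h : IsRun P ℱ G γ σ ε m₀ μ x) (hG : G.IsConvex)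
    (hmono : IsMonotoneOver G.mapping G.jointSet) (hlip : G.LipschitzMapping)
    (hgrowth : G.LinearGrowth) (hstep : AdmissibleSteps γ σ ε) {y : ℕ → Joint N d} {Y : ℝ}
    (hy : ∀ t, IsVISol G.jointSet (regularize G.mapping (ε t)) (y t)) (hyY : ∀ t, ‖y t‖ ≤ Y) :
    ∀ᵐ ω ∂P, Tendsto (fun t => ‖μ t ω - y (t - 1)‖ ^ 2) atTop (𝓝 0) := by
  obtain ⟨κ, hκ, hκsum, hrec⟩ :=
    h.exists_summable_condExp_norm_sub_sq_le hG hmono hlip hgrowth hstep Y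
  let α t := γ t * σ t ^ 2 * ε t
  let δ t := Y ^ 2 * (|ε (t - 1) - ε t| ^ 2 / ε t ^ 2)
  have hδ : ∀ t, 0 ≤ δ t := fun t => by positivity
  have hdrift : Summable fun t => (1 + 1 / α t) * δ t := by
    refine (summable_nat_add_iff 1).1 ((hstep.drift_sum.mul_left (Y ^ 2)).congr fun t => ?_)
    simp only [α, δ, Nat.add_sub_cancel]
    ring
  have hadp : StronglyAdapted ℱ fun t ω => ‖μ t ω - y (t - 1)‖ ^ 2 := fun t =>
    ((h.mean_meas t).stronglyMeasurable.sub stronglyMeasurable_const).norm.pow 2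
  refine ae_tendsto_zero_of_condExp_succ_le hadp
    (fun t => h.integrable_norm_mean_sub_sq hG hgrowth hstep.sigma_pos t _)
    (fun t ω => by positivity) (fun t => (hstep.beta_eps_pos t).le) hstep.beta_eps_sum
    (hκsum.mul_left 2) ((hdrift.mul_left (1 + ∑' t, κ t)).add hκsum) ?_
  filter_upwards [eventually_ge_atTop 1,
    hstep.tendsto_beta_eps.eventually_le_const one_half_pos] with t ht hα
  obtain ⟨t, rfl⟩ := Nat.exists_eq_add_of_le' ht
  filter_upwards [hrec t (y (t + 1)) (hy _) (hyY _)] with ω hω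
  exact hω.trans (contraction_add_error_le (hstep.beta_eps_pos _) hα (hκ _)
    (hκsum.le_tsum _ fun j _ => hκ j) (sq_nonneg _) (hδ _)
    (norm_sub_sq_le_of_isVISol_regularize hmono (hstep.eps_pos _) (hy _) (hy _) (hyY _)
      (hstep.beta_eps_pos _)))

theorem IsRun.ae_tendsto_mean [IsFiniteMeasure P]
    (h : IsRun P ℱ G γ σ ε m₀ μ x) (hG : G.IsConvex)
    (hmono : IsMonotoneOver G.mapping G.jointSet) (hlip : G.LipschitzMapping)
    (hgrowth : G.LinearGrowth) (hstep : AdmissibleSteps γ σ ε) {y : ℕ → Joint N d} {a : Joint N d}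
    (hy : ∀ t, IsVISol G.jointSet (regularize G.mapping (ε t)) (y t))
    (hya : Tendsto y atTop (𝓝 a)) :
    ∀ᵐ ω ∂P, Tendsto (fun t => μ t ω) atTop (𝓝 a) := by
  obtain ⟨Y, hY⟩ := hya.norm.bddAbove_range
  filter_upwards [h.ae_tendsto_norm_sub_regularized hG hmono hlip hgrowth hstep hy
    fun t => hY ⟨t, rfl⟩] with ω hω
  have hsub : Tendsto (fun t => μ t ω - y (t - 1)) atTop (𝓝 0) :=
    tendsto_zero_iff_norm_tendsto_zero.2 (by simpa using hω.sqrt)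
  simpa using hsub.add (hya.comp (tendsto_sub_atTop_nat 1))

theorem IsRun.eLpNorm_play_sub_mean [IsFiniteMeasure P] (h : IsRun P ℱ G γ σ ε m₀ μ x) (t : ℕ) :
    eLpNorm (fun ω => x t ω - μ t ω) 1 P =
      ‖σ t‖ₑ * ((∫⁻ z, ‖z‖ₑ ∂(stdGaussian (Joint N d))) * P Set.univ) := by
  have hpair : Measurable fun ω => (μ t ω, x t ω) :=
    (h.measurable_mean t).prodMk (h.measurable_play t)
  have hkernel (m : Joint N d) : ∫⁻ y, ‖y - m‖ₑ ∂(playKernel N d (σ t) m) =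
      ‖σ t‖ₑ * ∫⁻ z, ‖z‖ₑ ∂(stdGaussian (Joint N d)) := by
    rw [playKernel_apply, playLaw_eq_map_stdGaussian,
      lintegral_map (by fun_prop) (by fun_prop), ← lintegral_const_mul _ (by fun_prop)]
    simp only [add_sub_cancel_left, enorm_smul]
  calc eLpNorm (fun ω => x t ω - μ t ω) 1 P
      = ∫⁻ p, ‖p.2 - p.1‖ₑ ∂(P.map fun ω => (μ t ω, x t ω)) := by
        rw [eLpNorm_one_eq_lintegral_enorm, lintegral_map (by fun_prop) hpair]
    _ = ∫⁻ m, ∫⁻ y, ‖y - m‖ₑ ∂(playKernel N d (σ t) m) ∂(P.map (μ t)) := by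
        rw [(h.hasCondDistrib_play t).map_eq, Measure.lintegral_compProd (by fun_prop)]
    _ = _ := by
        simp only [hkernel]
        rw [lintegral_const, Measure.map_apply (h.measurable_mean t) .univ, Set.preimage_univ,
          mul_assoc]

theorem IsRun.tendstoInMeasure_play_sub_mean [IsFiniteMeasure P]
    (h : IsRun P ℱ G γ σ ε m₀ μ x) (hσ : Tendsto σ atTop (𝓝 0)) :
    TendstoInMeasure P (fun t ω => x t ω - μ t ω) atTop 0 := by
  refine tendstoInMeasure_of_tendsto_eLpNorm one_ne_zero
    (fun t => ((h.measurable_play t).sub (h.measurable_mean t)).aestronglyMeasurable)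
    aestronglyMeasurable_zero ?_
  simp_rw [sub_zero, h.eLpNorm_play_sub_mean]
  have hfin : (∫⁻ z, ‖z‖ₑ ∂(stdGaussian (Joint N d))) * P Set.univ ≠ ⊤ :=
    ENNReal.mul_ne_top (IsGaussian.integrable_id (μ := stdGaussian (Joint N d))).2.ne
      (measure_ne_top P _)
  have hσ0 : Tendsto (fun t => ‖σ t‖ₑ) atTop (𝓝 0) := by simpa using hσ.enorm
  simpa using ENNReal.Tendsto.mul_const hσ0 (Or.inr hfin)

theorem IsRun.tendstoInMeasure_play [IsFiniteMeasure P] (h : IsRun P ℱ G γ σ ε m₀ μ x)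
    (hσ : Tendsto σ atTop (𝓝 0)) {a : Joint N d}
    (hμ : ∀ᵐ ω ∂P, Tendsto (fun t => μ t ω) atTop (𝓝 a)) :
    TendstoInMeasure P x atTop fun _ => a := by
  have hmean : TendstoInMeasure P μ atTop fun _ => a :=
    tendstoInMeasure_of_tendsto_ae (fun t => (h.measurable_mean t).aestronglyMeasurable) hμ
  simpa using tendstoInMeasure_add (h.tendstoInMeasure_play_sub_mean hσ) hmean

end Convergence

end PayoffLearning

theorem theorem2_general {N d : ℕ} (G : PayoffLearning.Game N d)
    (hconvex : G.IsConvex)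
    (hmono : PayoffLearning.IsMonotoneOver G.mapping G.jointSet)
    (hsol : (PayoffLearning.viSol G.jointSet G.mapping).Nonempty)
    (hlip : G.LipschitzMapping)
    (hgrowth : G.LinearGrowth)
    {γ σ ε : ℕ → ℝ} (hstep : PayoffLearning.AdmissibleSteps γ σ ε)
    {Ω : Type*} [mΩ : MeasurableSpace Ω] (P : Measure Ω) [IsFiniteMeasure P]
    (ℱ : Filtration ℕ mΩ) (m₀ : PayoffLearning.Joint N d)
    (μ x : ℕ → Ω → PayoffLearning.Joint N d)
    (hrun : PayoffLearning.IsRun P ℱ G γ σ ε m₀ μ x) :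
    ∃ aStar : PayoffLearning.Joint N d,
      G.IsNash aStar ∧
      (∀ a', G.IsNash a' → ‖aStar‖ ≤ ‖a'‖) ∧
      (∀ᵐ ω ∂P, Tendsto (fun t => μ t ω) atTop (𝓝 aStar)) ∧
      TendstoInMeasure P x atTop (fun _ => aStar) := by
  obtain ⟨L, hL⟩ := hlip.exists_lipschitzWith
  have hclosed := hconvex.isClosed_jointSet
  have hmono' : PayoffLearning.IsMonotoneMapOn G.mapping G.jointSet := hmono
  have hne : G.jointSet.Nonempty := hsol.mono fun _ hs => hs.1
  choose! y hy using fun e (he : 0 < e) =>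
    hmono'.exists_isVISol_regularize hconvex.convex_jointSet hclosed hne hL.lipschitzOnWith he
  obtain ⟨aStar, hsolves, hmin, hlim⟩ :=
    hmono'.exists_tendsto_regularize hclosed hL.continuous.continuousOn hsol hy
  have hμ := hrun.ae_tendsto_mean hconvex hmono hlip hgrowth hstep
    (fun t => hy (ε t) (hstep.eps_pos t)) (hlim.comp hstep.tendsto_eps_nhdsGT)
  exact ⟨aStar, hconvex.isNash_iff.2 hsolves, fun a' ha' => hmin a' (hconvex.isNash_iff.1 ha'),
    hμ, hrun.tendstoInMeasure_play hstep.sigma_lim hμ⟩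

theorem theorem2 {N d : ℕ} (G : PayoffLearning.Game N d)
    (hconvex : G.IsConvex)
    (hmono : PayoffLearning.IsMonotoneOver G.mapping G.jointSet)
    (hsol : (PayoffLearning.viSol G.jointSet G.mapping).Nonempty)
    (hlip : G.LipschitzMapping)
    (hgrowth : G.LinearGrowth)
    {a b c : ℝ} {γ σ ε : ℕ → ℝ} (hstep : PayoffLearning.StepSizes a b c γ σ ε)
    {Ω : Type*} [mΩ : MeasurableSpace Ω] (P : Measure Ω) [IsProbabilityMeasure P]
    (ℱ : Filtration ℕ mΩ) (m₀ : PayoffLearning.Joint N d)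
    (μ x : ℕ → Ω → PayoffLearning.Joint N d)
    (hrun : PayoffLearning.IsRun P ℱ G γ σ ε m₀ μ x) :
    ∃ aStar : PayoffLearning.Joint N d,
      G.IsNash aStar ∧
      (∀ a', G.IsNash a' → ‖aStar‖ ≤ ‖a'‖) ∧
      (∀ᵐ ω ∂P, Tendsto (fun t => μ t ω) atTop (𝓝 aStar)) ∧
      TendstoInMeasure P x atTop (fun _ => aStar) := by
  exact theorem2_general G hconvex hmono hsol hlip hgrowth hstep.admissibleSteps P ℱ
    m₀ μ x hrun
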